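/- Let $K$ be an algebraically closed field of characteristic zero, $n\ge 1$, and let $B_n\subset GL_n(K)$ be the group of invertible upper triangular matrices. Let $R_n$ be the set of rook matrices, i.e. $0/1$ matrices of size $n\times n$ with at most one $1$ in each row and each column, partially ordered by $$r\le t\iff B_n r B_n\subseteq\overline{B_n t B_n}$$ (Zariski closure in $M_n(K)$). Let $P_n\subseteq R_n$ be the set of symmetric rook matrices (partial involutions), partially ordered by $$r\le t\iff \overline{B_n\cdot t}\subseteq\overline{B_n\cdot r},\qquad\text{where } b\cdot A=(b^{-1})^{\top}A\,b^{-1}\text{ for } b\in B_n .$$ For $1\le k\le n$ let $R_{n,k}\subseteq R_n$ and $P_{n,k}\subseteq P_n$ be the subposets (with the induced orders) of elements with exactly $k$ nonzero entries. A finite poset with a smallest and a largest element is graded if all its maximal chains have the same length; with $\rho$ its rank function, it is Eulerian if for all $x<y$ the interval $[x,y]$ contains as many elements $z$ with $\rho(z)$ odd as with $\rho(z)$ even. Then $R_{n,k}$ is Eulerian if and only if $k=n$ or $k=n-1$, and likewise $P_{n,k}$ is Eulerian if and only if $k=n$ or $k=n-1$. Moreover, if $k\le n-2$, then each of $R_{n,k}$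 and $P_{n,k}$ has a closed interval with exactly three elements. -/

import Mathlib

noncomputable section

/-! ### Finite graded and Eulerian posets -/

/-- A finite poset with a smallest and a largest element is graded if all of its maximal chains
have the same length. -/
def IsGradedPoset (α : Type*) [PartialOrder α] : Prop :=
  Finite α ∧ (∃ b : α, ∀ x, b ≤ x) ∧ (∃ t : α, ∀ x, x ≤ t) ∧
    ∃ N : ℕ, ∀ c : Set α, IsMaxChain (· ≤ ·) c → c.ncard = N + 1

/-- `ρ` is a rank function: it vanishes on minimal elements and goes up by one along covers. -/
def IsRankFunction {α : Type*} [PartialOrder α] (ρ : α → ℕ) : Prop :=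
  (∀ x, IsMin x → ρ x = 0) ∧ ∀ x y, x ⋖ y → ρ y = ρ x + 1

/-- A graded poset is Eulerian if every nontrivial closed interval has as many elements of odd
rank as of even rank. -/
def IsEulerianPoset (α : Type*) [PartialOrder α] : Prop :=
  IsGradedPoset α ∧ ∃ ρ : α → ℕ, IsRankFunction ρ ∧
    ∀ x y : α, x < y →
      {z ∈ Set.Icc x y | Odd (ρ z)}.ncard = {z ∈ Set.Icc x y | Even (ρ z)}.ncard

/-! ### Borel orbits and their Zariski closures -/

section Orbits

variable {n : ℕ} {K : Type*} [Field K]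

/-- The Zariski closure of a set of `n × n` matrices in the affine space of all such matrices. -/
def zariskiClosure (S : Set (Matrix (Fin n) (Fin n) K)) : Set (Matrix (Fin n) (Fin n) K) :=
  {X | (fun p : Fin n × Fin n => X p.1 p.2) ∈ MvPolynomial.zeroLocus K
    (MvPolynomial.vanishingIdeal K
      ((fun (Y : Matrix (Fin n) (Fin n) K) (p : Fin n × Fin n) => Y p.1 p.2) '' S))}

/-- The orbit of `A` under pairs `(b, c)` of invertible upper triangular matrices acting by
`(b, c) · A = b A c⁻¹`. -/
def borelOrbit (A : Matrix (Fin n) (Fin n) K) : Set (Matrix (Fin n) (Fin n) K) :=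
  {X | ∃ b c : GL (Fin n) K, b.1.IsUpperTriangular ∧ c.1.IsUpperTriangular ∧
    X = b.1 * A * (c⁻¹).1}

/-- The orbit of `A` under invertible upper triangular matrices acting by
`b · A = (b⁻¹)ᵀ A b⁻¹`. -/
def congruenceOrbit (A : Matrix (Fin n) (Fin n) K) : Set (Matrix (Fin n) (Fin n) K) :=
  {X | ∃ b : GL (Fin n) K, b.1.IsUpperTriangular ∧
    X = (b⁻¹).1.transpose * A * (b⁻¹).1}

/-- 0/1 matrices with at most one `1` in each row and each column. -/
def IsRook (x : Matrix (Fin n) (Fin n) K) : Prop :=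
  (∀ i j, x i j = 0 ∨ x i j = 1) ∧
    (∀ i j j', x i j = 1 → x i j' = 1 → j = j') ∧
    (∀ i i' j, x i j = 1 → x i' j = 1 → i = i')

/-- The number of nonzero entries. -/
def numNonzero (x : Matrix (Fin n) (Fin n) K) : ℕ :=
  {p : Fin n × Fin n | x p.1 p.2 ≠ 0}.ncard

end Orbits

/-- The rook monoid `R_n`, realized inside the `n × n` matrices over `K`. -/
def Rook (n : ℕ) (K : Type*) [Field K] : Type _ :=
  {x : Matrix (Fin n) (Fin n) K // IsRook x}

/-- The set `P_n` of partial involutions, i.e. of symmetric rooks. -/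
def PartialInvolution (n : ℕ) (K : Type*) [Field K] : Type _ :=
  {x : Matrix (Fin n) (Fin n) K // IsRook x ∧ x.IsSymm}

/-! ### Auxiliary facts: the closure orders are antisymmetric -/

section Aux

variable {n : ℕ} {K : Type*} [Field K]

theorem mem_zariskiClosure_iff {S : Set (Matrix (Fin n) (Fin n) K)}
    {X : Matrix (Fin n) (Fin n) K} :
    X ∈ zariskiClosure S ↔ ∀ p : MvPolynomial (Fin n × Fin n) K,
      (∀ Y ∈ S, MvPolynomial.eval (fun q : Fin n × Fin n => Y q.1 q.2) p = 0) →
        MvPolynomial.eval (fun q : Fin n × Fin n => X q.1 q.2) p = 0 := by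
  simp [zariskiClosure, MvPolynomial.aeval_eq_eval]

theorem subset_zariskiClosure (S : Set (Matrix (Fin n) (Fin n) K)) : S ⊆ zariskiClosure S :=
  fun _ hX => mem_zariskiClosure_iff.2 fun _ hp => hp _ hX

theorem zariskiClosure_subset {S T : Set (Matrix (Fin n) (Fin n) K)}
    (h : S ⊆ zariskiClosure T) : zariskiClosure S ⊆ zariskiClosure T :=
  fun _ hX => mem_zariskiClosure_iff.2 fun p hp =>
    mem_zariskiClosure_iff.1 hX p fun _ hY => mem_zariskiClosure_iff.1 (h hY) p hp

theorem self_mem_borelOrbit (A : Matrix (Fin n) (Fin n) K) : A ∈ borelOrbit A :=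
  ⟨1, 1, Matrix.blockTriangular_one, Matrix.blockTriangular_one, by simp⟩

theorem self_mem_congruenceOrbit (A : Matrix (Fin n) (Fin n) K) : A ∈ congruenceOrbit A :=
  ⟨1, Matrix.blockTriangular_one, by simp⟩

theorem isUpperTriangular_inv {c : GL (Fin n) K} (hc : c.1.IsUpperTriangular) :
    (c⁻¹).1.IsUpperTriangular := by
  have : Invertible c.1 := c.invertible
  have := Matrix.blockTriangular_inv_of_blockTriangular hc
  rwa [← Matrix.coe_units_inv] at this

open Classical in
/-- The number of ones of `x` in the block with rows in `I` and columns in `J`. -/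
def blockCount (x : Matrix (Fin n) (Fin n) K) (I J : Finset (Fin n)) : ℕ :=
  ∑ i ∈ I, ∑ j ∈ J, if x i j = 1 then 1 else 0

theorem blockCount_eq_card (x : Matrix (Fin n) (Fin n) K) (I J : Finset (Fin n)) :
    blockCount x I J =
      Nat.card {p : Fin n × Fin n // x p.1 p.2 = 1 ∧ p.1 ∈ I ∧ p.2 ∈ J} := by
  classical
  rw [Nat.card_eq_fintype_card, Fintype.card_subtype, blockCount, ← Finset.sum_product',
    ← Finset.sum_filter, Finset.sum_const, smul_eq_mul, mul_one]
  congr 1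
  ext p
  simp [and_comm]

/-- Block counts can only drop in the closure, for blocks adapted to the triangular action. -/
theorem blockCount_le {r t : Matrix (Fin n) (Fin n) K} (hr : IsRook r) (ht : IsRook t)
    {S : Set (Matrix (Fin n) (Fin n) K)} (I J : Finset (Fin n))
    (hS : ∀ Y ∈ S, ∃ b c : Matrix (Fin n) (Fin n) K, Y = b * t * c ∧
      (∀ i ∈ I, ∀ i' ∉ I, b i i' = 0) ∧ (∀ j ∈ J, ∀ j' ∉ J, c j' j = 0))
    (h : r ∈ zariskiClosure S) : blockCount r I J ≤ blockCount t I J := by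
  classical
  rw [blockCount_eq_card, blockCount_eq_card]
  set E := {p : Fin n × Fin n // r p.1 p.2 = 1 ∧ p.1 ∈ I ∧ p.2 ∈ J}
  set F := {p : Fin n × Fin n // t p.1 p.2 = 1 ∧ p.1 ∈ I ∧ p.2 ∈ J}
  by_contra hlt
  push Not at hlt
  rw [Nat.card_eq_fintype_card, Nat.card_eq_fintype_card] at hlt
  let P : MvPolynomial (Fin n × Fin n) K :=
    Matrix.det (Matrix.of fun p q : E => MvPolynomial.X (p.1.1, q.1.2))
  have hP : ∀ Y : Matrix (Fin n) (Fin n) K,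
      MvPolynomial.eval (fun q : Fin n × Fin n => Y q.1 q.2) P =
        Matrix.det (Matrix.of fun p q : E => Y p.1.1 q.1.2) := by
    intro Y
    simp only [P]
    rw [RingHom.map_det]
    congr 1
    ext p q
    simp
  have hr1 : (Matrix.of fun p q : E => r p.1.1 q.1.2) = 1 := by
    ext p q
    by_cases hpq : p = q
    · subst hpq
      simpa using p.2.1
    · rw [Matrix.one_apply_ne hpq, Matrix.of_apply]
      rcases hr.1 p.1.1 q.1.2 with h0 | h1
      · exact h0
      · exfalso
        apply hpq
        have e1 := hr.2.1 _ _ _ h1 p.2.1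
        have e2 := hr.2.2 _ _ _ h1 q.2.1
        exact Subtype.ext (Prod.ext e2 e1.symm)
  have h0 := mem_zariskiClosure_iff.1 h P ?_
  · rw [hP, hr1, Matrix.det_one] at h0
    exact one_ne_zero h0
  · intro Y hY
    rw [hP]
    obtain ⟨b, c, rfl, hb, hc⟩ := hS Y hY
    have hfac : (Matrix.of fun p q : E => (b * t * c) p.1.1 q.1.2) =
        (Matrix.of fun (p : E) (f : F) => b p.1.1 f.1.1) *
          (Matrix.of fun (f : F) (q : E) => c f.1.2 q.1.2) := by
      ext p q
      simp only [Matrix.of_apply, Matrix.mul_apply, Finset.sum_mul]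
      rw [Finset.sum_comm, ← Finset.sum_product']
      have hsub := Finset.sum_subtype (F := inferInstanceAs (Fintype F))
        (Finset.univ.filter fun f : Fin n × Fin n => t f.1 f.2 = 1 ∧ f.1 ∈ I ∧ f.2 ∈ J)
        (p := fun f : Fin n × Fin n => t f.1 f.2 = 1 ∧ f.1 ∈ I ∧ f.2 ∈ J) (by simp)
        (fun f : Fin n × Fin n => b p.1.1 f.1 * c f.2 q.1.2)
      refine Eq.trans ?_ hsub
      rw [Finset.univ_product_univ, Finset.sum_filter]
      refine Finset.sum_congr rfl fun f _ => ?_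
      by_cases hi : f.1 ∈ I
      · by_cases hj : f.2 ∈ J
        · rcases ht.1 f.1 f.2 with h0 | h1
          · simp [h0]
          · simp [h1, hi, hj]
        · simp [hj, hc _ q.2.2.2 _ hj]
      · simp [hi, hb _ p.2.2.1 _ hi]
    by_contra hdet
    have h1 := Matrix.rank_of_det_ne_zero hdet
    rw [hfac] at h1
    have h2 := Matrix.rank_mul_le_left (Matrix.of fun (p : E) (f : F) => b p.1.1 f.1.1)
          (Matrix.of fun (f : F) (q : E) => c f.1.2 q.1.2)
    have h3 := Matrix.rank_le_card_width (Matrix.of fun (p : E) (f : F) => b p.1.1 f.1.1)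
    omega

theorem eq_of_blockCount_eq {r t : Matrix (Fin n) (Fin n) K} (hr : IsRook r) (ht : IsRook t)
    (h : ∀ i j, ∃ I J : Finset (Fin n), i ∉ I ∧ j ∉ J ∧
      blockCount r I J = blockCount t I J ∧
      blockCount r (insert i I) J = blockCount t (insert i I) J ∧
      blockCount r I (insert j J) = blockCount t I (insert j J) ∧
      blockCount r (insert i I) (insert j J) = blockCount t (insert i I) (insert j J)) :
    r = t := by
  classical
  ext i j
  obtain ⟨I, J, hi, hj, h1, h2, h3, h4⟩ := h i j
  simp only [blockCount, Finset.sum_insert hi, Finset.sum_insert hj] at h1 h2 h3 h4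
  have key : (if r i j = 1 then 1 else 0) = if t i j = 1 then 1 else 0 := by omega
  rcases hr.1 i j with a | a <;> rcases ht.1 i j with b | b <;> simp [a, b] at key ⊢

theorem borelOrbit_blockCount_le {r t : Matrix (Fin n) (Fin n) K} (hr : IsRook r)
    (ht : IsRook t) (h : borelOrbit r ⊆ zariskiClosure (borelOrbit t)) (I J : Finset (Fin n))
    (hI : ∀ i ∈ I, ∀ i' ∉ I, i' < i) (hJ : ∀ j ∈ J, ∀ j' ∉ J, j < j') :
    blockCount r I J ≤ blockCount t I J := by
  refine blockCount_le hr ht I J ?_ (h (self_mem_borelOrbit r))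
  rintro Y ⟨b, c, hb, hc, rfl⟩
  exact ⟨_, _, rfl, fun i hi i' hi' => hb (hI i hi i' hi'),
    fun j hj j' hj' => isUpperTriangular_inv hc (hJ j hj j' hj')⟩

theorem congruenceOrbit_blockCount_le {r t : Matrix (Fin n) (Fin n) K} (hr : IsRook r)
    (ht : IsRook t) (h : congruenceOrbit r ⊆ zariskiClosure (congruenceOrbit t))
    (I J : Finset (Fin n)) (hI : ∀ i ∈ I, ∀ i' ∉ I, i < i') (hJ : ∀ j ∈ J, ∀ j' ∉ J, j < j') :
    blockCount r I J ≤ blockCount t I J := by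
  refine blockCount_le hr ht I J ?_ (h (self_mem_congruenceOrbit r))
  rintro Y ⟨b, hb, rfl⟩
  exact ⟨_, _, rfl, fun i hi i' hi' => isUpperTriangular_inv hb (hI i hi i' hi'),
    fun j hj j' hj' => isUpperTriangular_inv hb (hJ j hj j' hj')⟩

theorem borelOrbit_antisymm {r t : Matrix (Fin n) (Fin n) K} (hr : IsRook r) (ht : IsRook t)
    (h : borelOrbit r ⊆ zariskiClosure (borelOrbit t))
    (h' : borelOrbit t ⊆ zariskiClosure (borelOrbit r)) : r = t := by
  have key : ∀ I J : Finset (Fin n), (∀ i ∈ I, ∀ i' ∉ I, i' < i) → (∀ j ∈ J, ∀ j' ∉ J, j < j') →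
      blockCount r I J = blockCount t I J := fun I J hI hJ =>
    le_antisymm (borelOrbit_blockCount_le hr ht h I J hI hJ)
      (borelOrbit_blockCount_le ht hr h' I J hI hJ)
  refine eq_of_blockCount_eq hr ht fun i j =>
    ⟨Finset.Ioi i, Finset.Iio j, by simp, by simp, ?_, ?_, ?_, ?_⟩ <;>
  · apply key <;> intro a ha b hb <;> simp at ha hb <;> grind

theorem congruenceOrbit_antisymm {r t : Matrix (Fin n) (Fin n) K} (hr : IsRook r)
    (ht : IsRook t) (h : congruenceOrbit r ⊆ zariskiClosure (congruenceOrbit t))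
    (h' : congruenceOrbit t ⊆ zariskiClosure (congruenceOrbit r)) : r = t := by
  have key : ∀ I J : Finset (Fin n), (∀ i ∈ I, ∀ i' ∉ I, i < i') → (∀ j ∈ J, ∀ j' ∉ J, j < j') →
      blockCount r I J = blockCount t I J := fun I J hI hJ =>
    le_antisymm (congruenceOrbit_blockCount_le hr ht h I J hI hJ)
      (congruenceOrbit_blockCount_le ht hr h' I J hI hJ)
  refine eq_of_blockCount_eq hr ht fun i j =>
    ⟨Finset.Iio i, Finset.Iio j, by simp, by simp, ?_, ?_, ?_, ?_⟩ <;>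
  · apply key <;> intro a ha b hb <;> simp at ha hb <;> grind

end Aux

/-! ### The posets -/

/-- The Bruhat-Chevalley-Renner order: `r ≤ t` iff `B r B` lies in the Zariski closure of
`B t B`. -/
instance Rook.instPartialOrder (n : ℕ) (K : Type*) [Field K] : PartialOrder (Rook n K) where
  le r t := borelOrbit r.1 ⊆ zariskiClosure (borelOrbit t.1)
  le_refl r := subset_zariskiClosure _
  le_trans _ _ _ h₁ h₂ := h₁.trans (zariskiClosure_subset h₂)
  le_antisymm r t h₁ h₂ := Subtype.ext (borelOrbit_antisymm r.2 t.2 h₁ h₂)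

/-- The opposite of the inclusion order of the closures of the congruence orbits: `r ≤ t` iff the
closure of the orbit of `t` is contained in the closure of the orbit of `r`. -/
instance PartialInvolution.instPartialOrder (n : ℕ) (K : Type*) [Field K] :
    PartialOrder (PartialInvolution n K) where
  le r t := zariskiClosure (congruenceOrbit t.1) ⊆ zariskiClosure (congruenceOrbit r.1)
  le_refl r := subset_rfl
  le_trans _ _ _ h₁ h₂ := h₂.trans h₁
  le_antisymm r t h₁ h₂ := Subtype.ext (congruenceOrbit_antisymm r.2.1 t.2.1
    ((subset_zariskiClosure _).trans h₂) ((subset_zariskiClosure _).trans h₁))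

/-- `R_{n,k}`: rooks with exactly `k` nonzero entries, with the order induced from `R_n`. -/
def rookStratum (n k : ℕ) (K : Type*) [Field K] : Set (Rook n K) :=
  {x | numNonzero x.1 = k}

/-- `P_{n,k}`: partial involutions with exactly `k` nonzero entries, with the order induced from
`P_n`. -/
def partialInvolutionStratum (n k : ℕ) (K : Type*) [Field K] : Set (PartialInvolution n K) :=
  {x | numNonzero x.1 = k}

end

/-! The closure orders are compared with the combinatorial order `RankLE`, which counts ones in
upper left blocks. Ranks of such blocks can only drop under degeneration, so for every `k` the
closure order implies the rank order. For `R_{n,k}` the rows are first reversed, which turns the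
Borel double orbits into lower-upper orbits and reverses the direction of the order.

If `k ≥ n - 1`, at most one row and one column are empty, so interchanging adjacent rows or columns
never fixes a rook matrix. These interchanges move every element to a comparable one, have the
lifting property of Bruhat orders, and leave only one element without descents
(`RankRook.isLiftingSystem_swap`). For symmetric rooks the same holds for conjugation by an adjacent
transposition, replaced by one-sided multiplication when conjugation acts trivially
(`SymmRankRook.isLiftingSystem_swap`).

Such a structure makes a nonempty finite poset Eulerian (`IsLiftingSystem.isEulerianPoset`): the
involutions are covers, diamonds give a rank function, and an involution that is a descent of `y`
and an ascent of `x` matches odd with even ranks in `[x, y]`. The remaining intervals follow by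
induction.

The structure also generates the order: `x ≤ y` is forced by transitivity and stability under the
ascents of `x` (`IsLiftingSystem.rel_of_le`). Orbit closures have this stability because they are
stable under the minimal parabolic subgroups of the ascents. On a dense part of the parabolic, a
lower triangular column operation can be traded for a row operation. In the congruence case this
first gives only a two-sided equivalence; `mem_congruenceOrbit_of_mem_lowerUpperOrbit` turns it into
a congruence by means of a square root of a triangular matrix. Hence closure order and rank order
agree for `k ≥ n - 1`.

If `k ≤ n - 2`, there is room for a single one to slide through three consecutive positions while
all other ones stay fixed. The two steps are ascents, hence hold in the closure order, and the rank
inequalities exclude any further element between the ends. Three is odd, so the poset is not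
Eulerian. -/

/-! ### Posets with a lifting property -/

/-- A family of fixed-point-free involutions of a poset, each moving every element to a comparable
one, which satisfies the lifting property of Bruhat orders, and for which there is at most one
element without descents. -/
structure IsLiftingSystem {α ι : Type*} [PartialOrder α] (M : ι → α → α) : Prop where
  invol : ∀ s x, M s (M s x) = x
  ne : ∀ s x, M s x ≠ x
  total : ∀ s x, M s x ≤ x ∨ x ≤ M s x
  lift : ∀ s x y, x ≤ y → M s y ≤ y → x ≤ M s x → x ≤ M s y ∧ M s x ≤ y
  uniq : ∀ x y, (∀ s, x ≤ M s x) → (∀ s, y ≤ M s y) → x = y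

namespace IsLiftingSystem

variable {α ι : Type*} [PartialOrder α] {M : ι → α → α}

/-! ### Consequences of the lifting property in an arbitrary poset. -/

section Basic

variable (h : IsLiftingSystem M)
include h

theorem lt_of_le {s : ι} {x : α} (hx : M s x ≤ x) : M s x < x :=
  lt_of_le_of_ne hx (h.ne s x)

theorem lt_of_le' {s : ι} {x : α} (hx : x ≤ M s x) : x < M s x :=
  lt_of_le_of_ne hx (h.ne s x).symm

theorem injective (s : ι) : Function.Injective (M s) := fun x y hxy => by
  rw [← h.invol s x, hxy, h.invol]

theorem apply_le {s : ι} {x y : α} (hxy : x ≤ y) (hy : M s y ≤ y) : M s x ≤ y := by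
  rcases h.total s x with hx | hx
  · exact hx.trans hxy
  · exact (h.lift s x y hxy hy hx).2

theorem le_apply {s : ι} {x y : α} (hxy : x ≤ y) (hx : x ≤ M s x) : x ≤ M s y := by
  rcases h.total s y with hy | hy
  · exact (h.lift s x y hxy hy hx).1
  · exact hxy.trans hy

theorem apply_le_apply {s : ι} {x y : α} (hxy : x ≤ y) (hx : M s x ≤ x) :
    M s x ≤ M s y :=
  h.le_apply (hx.trans hxy) (by rwa [h.invol])

theorem apply_le_apply' {s : ι} {x y : α} (hxy : x ≤ y) (hy : y ≤ M s y) :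
    M s x ≤ M s y :=
  h.apply_le (hxy.trans hy) (by rwa [h.invol])

/-- Let `z` lie strictly between. If `s` is an ascent of `z`, lifting puts `z` below `M s y`. If it
is a descent, `M s z` is squeezed to `M s y`, so `z = y`. -/
theorem covBy_of_le {s : ι} {y : α} (hy : M s y ≤ y) : M s y ⋖ y := by
  refine ⟨h.lt_of_le hy, fun z hz hzy => ?_⟩
  rcases h.total s z with hsz | hsz
  · have h1 := h.apply_le_apply hzy.le hsz
    have h2 := h.le_apply hz.le (s := s) (by rwa [h.invol])
    exact hzy.ne (h.injective s (le_antisymm h1 h2))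
  · exact hz.not_ge (h.le_apply hzy.le hsz)

/-- Diamond property: a cover of `y` other than the one given by `s` is carried by `M s` to a
parallel cover. This is the induction step for the rank function. -/
theorem covBy_apply {s : ι} {x y : α} (hxy : x ⋖ y) (hy : M s y ≤ y) (hne : x ≠ M s y) :
    M s x ≤ x ∧ M s x ⋖ M s y := by
  have hx : M s x ≤ x := by
    rcases h.total s x with hx | hx
    · exact hx
    · have h1 := h.le_apply hxy.le hx
      exact absurd (h.lt_of_le hy) (hxy.2 (lt_of_le_of_ne h1 hne))
  refine ⟨hx, lt_of_le_of_ne (h.apply_le_apply hxy.le hx)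
    fun e => hxy.lt.ne (h.injective s e), fun z hz hzy => ?_⟩
  rcases h.total s z with hsz | hsz
  · have h1 := h.apply_le hz.le hsz
    rw [h.invol] at h1
    exact hxy.2 (lt_of_le_of_lt h1 hzy) (h.lt_of_le hy)
  · have h1 : M s z ≤ y := h.apply_le (hzy.le.trans hy) hy
    have h2 : x ≤ M s z := by
      have := h.apply_le (hz.le.trans hsz) (s := s) (by rwa [h.invol])
      rwa [h.invol] at this
    refine hxy.2 (lt_of_le_of_ne h2 ?_) (lt_of_le_of_ne h1 ?_)
    · rintro rfl
      rw [h.invol] at hz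
      exact hz.ne rfl
    · rintro rfl
      rw [h.invol] at hzy
      exact hzy.ne rfl

end Basic

/-! ### Extremal elements, generation of the order, duality and rank in the finite case. -/

section Finite

variable [Finite α] (h : IsLiftingSystem M)
include h

/-- Going down along descents from any `x` ends at an element without descents, which is `b` by
uniqueness. -/
theorem le_of_forall_le {b : α} (hb : ∀ s, b ≤ M s b) (x : α) : b ≤ x := by
  induction x using WellFoundedLT.induction with
  | _ x ih =>
    by_cases hx : ∀ s, x ≤ M s x
    · exact (h.uniq b x hb hx).le
    · push Not at hx
      obtain ⟨s, hs⟩ := hx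
      have hs' := (h.total s x).resolve_right hs
      exact (ih _ (h.lt_of_le hs')).trans hs'

theorem exists_le_apply [Nonempty α] : ∃ b : α, ∀ s, b ≤ M s b := by
  obtain ⟨b, hb⟩ := (Set.toFinite (Set.univ : Set α)).exists_minimal Set.univ_nonempty
  exact ⟨b, fun s => (h.total s b).elim (fun e => hb.2 trivial e) id⟩

theorem exists_bot [Nonempty α] : ∃ b : α, ∀ x, b ≤ x :=
  let ⟨b, hb⟩ := h.exists_le_apply
  ⟨b, h.le_of_forall_le hb⟩

/-- Climbing back from the bottom to `x` along the same descents stays below `t`, since each step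
used is also a descent of `t`. -/
theorem le_of_forall_apply_le {t : α} (ht : ∀ s, M s t ≤ t) (x : α) : x ≤ t := by
  induction x using WellFoundedLT.induction with
  | _ x ih =>
    by_cases hx : ∀ s, x ≤ M s x
    · exact h.le_of_forall_le hx t
    · push Not at hx
      obtain ⟨s, hs⟩ := hx
      have hs' := (h.total s x).resolve_right hs
      have := h.apply_le (ih _ (h.lt_of_le hs')) (ht s)
      rwa [h.invol] at this

theorem exists_top [Nonempty α] : ∃ t : α, ∀ x, x ≤ t := by
  obtain ⟨t, ht⟩ := (Set.toFinite (Set.univ : Set α)).exists_maximal Set.univ_nonempty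
  exact ⟨t, h.le_of_forall_apply_le fun s => (h.total s t).elim id fun e => ht.2 trivial e⟩

/-- The order is the smallest reflexive transitive relation `G` whose upper sets at `x` are stable
under the involutions going up at `x`. -/
theorem rel_of_le {G : α → α → Prop} (hrefl : ∀ x, G x x)
    (htrans : ∀ x y z, G x y → G y z → G x z)
    (hstab : ∀ s x z, x ≤ M s x → G x z → G x (M s z)) {x y : α} (hxy : x ≤ y) : G x y := by
  induction x using WellFoundedGT.induction generalizing y with
  | _ x ih =>
    by_cases hx : ∀ s, M s x ≤ x
    · rw [le_antisymm hxy (h.le_of_forall_apply_le hx y)]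
      exact hrefl y
    · push Not at hx
      obtain ⟨s, hs⟩ := hx
      have hs' := (h.total s x).resolve_left hs
      -- Replace `x` by the larger `M s x`. If `s` is a descent of `y`, then `M s x ≤ y`. Otherwise
      -- `M s x ≤ M s y`, and stability at `x` brings `M s y` back to `y`.
      have hG := hstab s x x hs' (hrefl x)
      rcases h.total s y with hy | hy
      · exact htrans _ _ _ hG (ih _ (h.lt_of_le' hs') (h.apply_le hxy hy))
      · have := htrans _ _ _ hG (ih _ (h.lt_of_le' hs') (h.apply_le_apply' hxy hy))
        have := hstab s x _ hs' this
        rwa [h.invol] at this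

omit [Finite α] in
theorem of_orderIso {β : Type*} [PartialOrder β] (e : β ≃o α) :
    IsLiftingSystem fun s x => e.symm (M s (e x)) where
  invol s x := by simp [h.invol]
  ne s x hx := h.ne s (e x) (by rw [OrderIso.symm_apply_eq] at hx; exact hx)
  total s x := by
    simp only [e.symm_apply_le, e.le_symm_apply]
    exact h.total s (e x)
  lift s x y hxy hy hx := by
    simp only [e.symm_apply_le, e.le_symm_apply] at hy hx ⊢
    exact h.lift s _ _ (e.monotone hxy) hy hx
  uniq x y hx hy := by
    simp only [e.le_symm_apply] at hx hy
    exact e.injective (h.uniq _ _ hx hy)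

/-- All conditions but uniqueness are self-dual. An element without ascents is a top element, hence
unique; this is where finiteness enters. -/
theorem dual :
    IsLiftingSystem (α := αᵒᵈ) fun s x => OrderDual.toDual (M s (OrderDual.ofDual x)) where
  invol s x := h.invol s (OrderDual.ofDual x)
  ne s x := h.ne s (OrderDual.ofDual x)
  total s x := (h.total s (OrderDual.ofDual x)).symm
  lift s x y hxy hy hx :=
    (h.lift s (OrderDual.ofDual y) (OrderDual.ofDual x) hxy hx hy).symm
  uniq x y hx hy :=
    le_antisymm (α := α) (h.le_of_forall_apply_le hy (OrderDual.ofDual x))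
      (h.le_of_forall_apply_le hx (OrderDual.ofDual y))

/-- The rank is defined by recursion along one arbitrarily chosen descent of each element. Any other
cover of `y` completes to a diamond through `covBy_apply`, so its rank is the same by induction. -/
theorem exists_rank : ∃ ρ : α → ℕ, IsRankFunction ρ := by
  classical
  let wf : WellFounded ((· < ·) : α → α → Prop) := wellFounded_lt
  let F : ∀ y : α, (∀ x, x < y → ℕ) → ℕ := fun y ih =>
    if hy : ∃ s, M s y ≤ y then ih (M hy.choose y) (h.lt_of_le hy.choose_spec) + 1 else 0
  let ρ : α → ℕ := wf.fix F
  have hρ : ∀ y, ρ y = F y fun x _ => ρ x := fun y => wf.fix_eq F y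
  refine ⟨ρ, fun x hx => ?_, fun x y => ?_⟩
  · rw [hρ]
    refine dif_neg ?_
    rintro ⟨s, hs⟩
    exact hs.not_gt (lt_of_le_of_ne (hx hs) (h.ne s x).symm)
  · induction y using wf.induction generalizing x with
    | _ y ih =>
      intro hxy
      have hy : ∃ s, M s y ≤ y := by
        by_contra hy
        push Not at hy
        exact hxy.lt.not_ge
          (h.le_of_forall_le (fun s => (h.total s y).resolve_left (hy s)) x)
      have hs := hy.choose_spec
      have e : ρ y = ρ (M hy.choose y) + 1 := by
        rw [hρ y]
        exact dif_pos hy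
      rw [e]
      by_cases hne : x = M hy.choose y
      · rw [← hne]
      · obtain ⟨hx, hc⟩ := h.covBy_apply hxy hs hne
        rw [ih _ (h.lt_of_le hs) _ hc, ih x hxy.lt _ (h.covBy_of_le hx)]

end Finite

end IsLiftingSystem

/-! ### Rank functions and gradedness. -/

theorem IsRankFunction.strictMono {α : Type*} [PartialOrder α] [Finite α] {ρ : α → ℕ}
    (hρ : IsRankFunction ρ) : StrictMono ρ := by
  classical
  have := Fintype.ofFinite α
  let _ : LocallyFiniteOrder α := Fintype.toLocallyFiniteOrder
  exact (strictMono_iff_forall_covBy ρ).2 fun x y hxy =>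
    (hρ.2 x y hxy).symm ▸ Nat.lt_succ_self _

/-- A finite bounded poset with a rank function is graded. -/
theorem IsRankFunction.isGradedPoset {α : Type*} [PartialOrder α] [Finite α] {ρ : α → ℕ}
    (hρ : IsRankFunction ρ) (hbot : ∃ b : α, ∀ x, b ≤ x) (htop : ∃ t : α, ∀ x, x ≤ t) :
    IsGradedPoset α := by
  refine ⟨inferInstance, hbot, htop, ?_⟩
  obtain ⟨b, hb⟩ := hbot
  obtain ⟨t, ht⟩ := htop
  have hmono := hρ.strictMono
  refine ⟨ρ t, fun c hc => ?_⟩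
  have hmem : ∀ z, (∀ w ∈ c, z ≤ w ∨ w ≤ z) → z ∈ c := fun z hz => by
    have := hc.2 (t := insert z c) (hc.1.insert fun w hw _ => hz w hw) (Set.subset_insert _ _)
    rw [this]
    exact Set.mem_insert _ _
  have hle : ∀ x ∈ c, ∀ y ∈ c, ρ x ≤ ρ y → x ≤ y := fun x hx y hy hxy => by
    rcases eq_or_ne x y with rfl | hne
    · exact le_rfl
    · exact (hc.1 hx hy hne).resolve_right fun h =>
        (hmono (lt_of_le_of_ne h hne.symm)).not_ge hxy
  -- If a rank `v` were missed, the nearest elements `x`, `y` of the chain below and above `v` would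
  -- differ in rank by at least two, so they would not form a cover. An element strictly between
  -- them is comparable to the whole chain, against maximality.
  have himage : ρ '' c = Set.Iic (ρ t) := by
    ext v
    refine ⟨?_, fun hv => ?_⟩
    · rintro ⟨x, -, rfl⟩
      exact hmono.monotone (ht x)
    · by_contra hcon
      have hne : ∀ w ∈ c, ρ w ≠ v := fun w hw e => hcon ⟨w, hw, e⟩
      have hbv : ρ b < v := lt_of_le_of_ne
        (by rw [hρ.1 b fun x _ => hb x]; exact Nat.zero_le v)
        (hne b (hmem b fun w _ => Or.inl (hb w)))
      have htv : v < ρ t := lt_of_le_of_ne hv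
        (hne t (hmem t fun w _ => Or.inr (ht w))).symm
      obtain ⟨x, ⟨hxc, hxv⟩, hx⟩ := Set.exists_max_image {w ∈ c | ρ w < v} ρ (Set.toFinite _)
        ⟨b, hmem b fun w _ => Or.inl (hb w), hbv⟩
      obtain ⟨y, ⟨hyc, hyv⟩, hy⟩ := Set.exists_min_image {w ∈ c | v < ρ w} ρ (Set.toFinite _)
        ⟨t, hmem t fun w _ => Or.inr (ht w), htv⟩
      have hxy : x < y := lt_of_le_of_ne (hle x hxc y hyc (hxv.trans hyv).le)
        fun e => (hxv.trans hyv).ne (congrArg ρ e)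
      have hcov : ¬ x ⋖ y := fun h => by
        have := hρ.2 x y h
        omega
      obtain ⟨z, hxz, hzy⟩ := (not_covBy_iff hxy).1 hcov
      have hsep : ∀ w ∈ c, w ≤ x ∨ y ≤ w := fun w hw => by
        rcases lt_or_gt_of_ne (hne w hw) with h | h
        · exact Or.inl (hle w hw x hxc (hx w ⟨hw, h⟩))
        · exact Or.inr (hle y hyc w hw (hy w ⟨hw, h⟩))
      have hz : z ∈ c := hmem z fun w hw => (hsep w hw).symm.imp
        (fun h => hzy.le.trans h) fun h => h.trans hxz.le
      rcases hsep z hz with h | h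
      · exact hxz.not_ge h
      · exact hzy.not_ge h
  have hinj : Set.InjOn ρ c := fun x hx y hy e =>
    le_antisymm (hle x hx y hy e.le) (hle y hy x hx e.ge)
  rw [← hinj.ncard_image, himage, ← Set.Iio_succ_eq_Iic, Set.ncard_eq_toFinset_card']
  simp

/-! ### Signed counts and the Eulerian property. -/

theorem IsRankFunction.neg_one_pow_apply {α ι : Type*} [PartialOrder α] {M : ι → α → α}
    {ρ : α → ℕ} (hρ : IsRankFunction ρ) (h : IsLiftingSystem M) (s : ι) (x : α) :
    (-1 : ℤ) ^ ρ x + (-1) ^ ρ (M s x) = 0 := by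
  rcases h.total s x with hx | hx
  · rw [hρ.2 _ _ (h.covBy_of_le hx), pow_succ]
    ring
  · have hx' := h.covBy_of_le (s := s) (y := M s x) (by rwa [h.invol])
    rw [h.invol] at hx'
    rw [hρ.2 _ _ hx', pow_succ]
    ring

open Classical in
/-- Signed count of the elements of a closed interval. -/
theorem IsLiftingSystem.sum_neg_one_pow_eq_zero {α ι : Type*} [PartialOrder α] [Fintype α]
    {M : ι → α → α} (h : IsLiftingSystem M) {ρ : α → ℕ} (hρ : IsRankFunction ρ) {x y : α}
    (hxy : x < y) : ∑ z with x ≤ z ∧ z ≤ y, (-1 : ℤ) ^ ρ z = 0 := by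
  induction y using WellFoundedLT.induction generalizing x with
  | ind y ih =>
    obtain ⟨s, hs⟩ : ∃ s, M s y ≤ y := by
      by_contra hy
      push Not at hy
      exact hxy.not_ge (h.le_of_forall_le (fun s => (h.total s y).resolve_left (hy s)) x)
    -- When `s` is an ascent of the lower end and a descent of the upper end, `M s` preserves the
    -- interval and flips the sign of every term.
    have key : ∀ x : α, x ≤ M s x → ∑ z with x ≤ z ∧ z ≤ y, (-1 : ℤ) ^ ρ z = 0 := by
      intro x hx
      refine Finset.sum_involution (fun z _ => M s z)
        (fun z _ => hρ.neg_one_pow_apply h s z) (fun z _ _ => h.ne s z) (fun z hz => ?_)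
        (fun z _ => h.invol s z)
      rw [Finset.mem_filter] at hz ⊢
      exact ⟨Finset.mem_univ _, h.le_apply hz.2.1 hx, h.apply_le hz.2.2 hs⟩
    rcases h.total s x with hx | hx
    swap
    · exact key x hx
    have hs' := h.lt_of_le hs
    have h1 := key (M s x) (by rwa [h.invol])
    have h2 := ih _ hs' (lt_of_le_of_ne (h.apply_le_apply hxy.le hx)
      fun e => hxy.ne (h.injective s e))
    have h3 : ∑ z with x ≤ z ∧ z ≤ M s y, (-1 : ℤ) ^ ρ z = 0 := by
      by_cases hle : x ≤ M s y
      · refine ih _ hs' (lt_of_le_of_ne hle fun e => ?_)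
        rw [e, h.invol] at hx
        exact hx.not_gt hs'
      · rw [Finset.filter_false_of_mem fun z _ hz => hle (hz.1.trans hz.2), Finset.sum_empty]
    have split : ∀ w : α, ∑ z with M s x ≤ z ∧ z ≤ w, (-1 : ℤ) ^ ρ z =
        ∑ z with x ≤ z ∧ z ≤ w, (-1 : ℤ) ^ ρ z +
          ∑ z with (M s x ≤ z ∧ z ≤ w) ∧ ¬ x ≤ z, (-1 : ℤ) ^ ρ z := by
      intro w
      rw [← Finset.sum_filter_add_sum_filter_not _ (fun z => x ≤ z), Finset.filter_filter,
        Finset.filter_filter]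
      congr 2
      ext z
      simp only [Finset.mem_filter, Finset.mem_univ, true_and]
      exact ⟨fun hz => ⟨hz.2, hz.1.2⟩, fun hz => ⟨⟨hx.trans hz.1, hz.2⟩, hz.1⟩⟩
    -- Above `M s x` but not above `x`, the involution can only go up, and an ascent `z ≤ y` already
    -- satisfies `z ≤ M s y`. So the intervals from `M s x` to `y` and to `M s y` exceed those from
    -- `x` by the same set. Three of the four sums vanish, hence so does the fourth.
    have same : (Finset.univ.filter fun z => (M s x ≤ z ∧ z ≤ y) ∧ ¬ x ≤ z) =
        Finset.univ.filter fun z => (M s x ≤ z ∧ z ≤ M s y) ∧ ¬ x ≤ z := by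
      ext z
      simp only [Finset.mem_filter, Finset.mem_univ, true_and]
      refine ⟨fun hz => ⟨⟨hz.1.1, ?_⟩, hz.2⟩, fun hz => ⟨⟨hz.1.1, hz.1.2.trans hs⟩, hz.2⟩⟩
      rcases h.total s z with hsz | hsz
      · have := h.apply_le hz.1.1 hsz
        rw [h.invol] at this
        exact absurd this hz.2
      · exact h.le_apply hz.1.2 hsz
    have h4 := split y
    have h5 := split (M s y)
    rw [same] at h4
    omega

/-- A nonempty finite poset with a lifting system is Eulerian. -/
theorem IsLiftingSystem.isEulerianPoset {α ι : Type*} [PartialOrder α] [Finite α] [Nonempty α]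
    {M : ι → α → α} (h : IsLiftingSystem M) : IsEulerianPoset α := by
  classical
  have := Fintype.ofFinite α
  obtain ⟨ρ, hρ⟩ := h.exists_rank
  refine ⟨hρ.isGradedPoset h.exists_bot h.exists_top, ρ, hρ, fun x y hxy => ?_⟩
  have hsum := h.sum_neg_one_pow_eq_zero hρ hxy
  rw [← Finset.sum_filter_add_sum_filter_not _ (fun z => Odd (ρ z)),
    Finset.sum_congr (g := fun _ => (-1 : ℤ)) rfl
      fun z hz => (Finset.mem_filter.1 hz).2.neg_one_pow,
    Finset.sum_congr (g := fun _ => (1 : ℤ)) (s₁ := Finset.filter (fun z => ¬ Odd (ρ z)) _) rfl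
      fun z hz => (Nat.not_odd_iff_even.1 (Finset.mem_filter.1 hz).2).neg_one_pow,
    Finset.sum_const, Finset.sum_const, Finset.filter_filter, Finset.filter_filter] at hsum
  rw [Set.ncard_eq_toFinset_card', Set.ncard_eq_toFinset_card']
  have e1 : {z ∈ Set.Icc x y | Odd (ρ z)}.toFinset =
      Finset.univ.filter fun z => (x ≤ z ∧ z ≤ y) ∧ Odd (ρ z) := by
    ext z
    simp
  have e2 : {z ∈ Set.Icc x y | Even (ρ z)}.toFinset =
      Finset.univ.filter fun z => (x ≤ z ∧ z ≤ y) ∧ ¬ Odd (ρ z) := by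
    ext z
    simp
  rw [e1, e2]
  simp only [nsmul_eq_mul, mul_neg, mul_one] at hsum
  omega

/-- A closed interval with three elements obstructs being Eulerian. -/
theorem not_isEulerianPoset_of_ncard_Icc {α : Type*} [PartialOrder α] {x y : α}
    (h : (Set.Icc x y).ncard = 3) : ¬ IsEulerianPoset α := by
  rintro ⟨⟨hfin, -⟩, ρ, -, hE⟩
  have hxy : x < y := by
    by_contra hlt
    have hsub : (Set.Icc x y).Subsingleton := fun a ha b hb => by
      have : x = y := eq_of_le_of_not_lt (ha.1.trans ha.2) hlt
      subst this
      exact (le_antisymm ha.2 ha.1).trans (le_antisymm hb.2 hb.1).symm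
    have := Set.ncard_le_one_iff_subsingleton.2 hsub
    omega
  have hunion : {z ∈ Set.Icc x y | Odd (ρ z)} ∪ {z ∈ Set.Icc x y | Even (ρ z)} = Set.Icc x y := by
    ext z
    simp only [Set.mem_union, Set.mem_ofPred_eq, ← and_or_left]
    exact and_iff_left (Nat.even_or_odd (ρ z)).symm
  have hdisj : Disjoint {z ∈ Set.Icc x y | Odd (ρ z)} {z ∈ Set.Icc x y | Even (ρ z)} :=
    Set.disjoint_left.2 fun z h1 h2 => Nat.not_even_iff_odd.2 h1.2 h2.2
  have hcard := Set.ncard_union_eq hdisj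
  rw [hunion, hE x y hxy] at hcard
  omega

/-! ### Rank conditions on rook matrices -/

section RankOrder

variable {n : ℕ} {K : Type*} [Field K]

theorem blockCount_insert (x : Matrix (Fin n) (Fin n) K) {i : Fin n} {I : Finset (Fin n)}
    (hi : i ∉ I) (J : Finset (Fin n)) :
    blockCount x (insert i I) J = blockCount x {i} J + blockCount x I J := by
  simp only [blockCount, Finset.sum_insert hi, Finset.sum_singleton]

theorem blockCount_transpose (x : Matrix (Fin n) (Fin n) K) (I J : Finset (Fin n)) :
    blockCount x.transpose J I = blockCount x I J := by
  simp only [blockCount, Matrix.transpose_apply]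
  exact Finset.sum_comm

theorem blockCount_submatrix (x : Matrix (Fin n) (Fin n) K) (σ τ : Equiv.Perm (Fin n))
    (I J : Finset (Fin n)) :
    blockCount (x.submatrix σ τ) I J =
      blockCount x (I.map σ.toEmbedding) (J.map τ.toEmbedding) := by
  simp only [blockCount, Finset.sum_map, Matrix.submatrix_apply]
  rfl

theorem blockCount_mono (x : Matrix (Fin n) (Fin n) K) {I I' J J' : Finset (Fin n)}
    (hI : I ⊆ I') (hJ : J ⊆ J') : blockCount x I J ≤ blockCount x I' J' := by
  unfold blockCount
  exact (Finset.sum_le_sum fun i _ => Finset.sum_le_sum_of_subset hJ).trans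
    (Finset.sum_le_sum_of_subset hI)

theorem blockCount_eq_zero {x : Matrix (Fin n) (Fin n) K} {I J : Finset (Fin n)} :
    blockCount x I J = 0 ↔ ∀ i ∈ I, ∀ j ∈ J, x i j ≠ 1 := by
  simp [blockCount, Finset.sum_eq_zero_iff]

theorem blockCount_singleton_pos {x : Matrix (Fin n) (Fin n) K} {i : Fin n}
    {J : Finset (Fin n)} : 1 ≤ blockCount x {i} J ↔ ∃ j ∈ J, x i j = 1 := by
  rw [Nat.one_le_iff_ne_zero, ne_eq, blockCount_eq_zero]
  simp

theorem blockCount_singleton_singleton {x : Matrix (Fin n) (Fin n) K} {i j : Fin n} :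
    1 ≤ blockCount x {i} {j} ↔ x i j = 1 := by
  rw [blockCount_singleton_pos]
  simp

theorem blockCount_eq_sum_rows (x : Matrix (Fin n) (Fin n) K) (I J : Finset (Fin n)) :
    blockCount x I J = ∑ i ∈ I, blockCount x {i} J := by
  simp [blockCount]

namespace IsRook

variable {x : Matrix (Fin n) (Fin n) K}

theorem transpose (hx : IsRook x) : IsRook x.transpose :=
  ⟨fun i j => hx.1 j i, fun i j j' h h' => hx.2.2 j j' i h h',
    fun i i' j h h' => hx.2.1 j i i' h h'⟩

theorem submatrix (hx : IsRook x) (σ τ : Equiv.Perm (Fin n)) : IsRook (x.submatrix σ τ) :=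
  ⟨fun _ _ => hx.1 _ _, fun _ _ _ h h' => τ.injective (hx.2.1 _ _ _ h h'),
    fun _ _ _ h h' => σ.injective (hx.2.2 _ _ _ h h')⟩

theorem ext {y : Matrix (Fin n) (Fin n) K} (hx : IsRook x) (hy : IsRook y)
    (h : ∀ i j, x i j = 1 ↔ y i j = 1) : x = y := by
  ext i j
  have := h i j
  rcases hx.1 i j with a | a <;> rcases hy.1 i j with b | b <;> simp_all

theorem blockCount_singleton_le (hx : IsRook x) (i : Fin n) (J : Finset (Fin n)) :
    blockCount x {i} J ≤ 1 := by
  classical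
  simp only [blockCount, Finset.sum_singleton, Finset.sum_boole, Nat.cast_id]
  refine Finset.card_le_one.2 fun a ha b hb => ?_
  exact hx.2.1 i a b (Finset.mem_filter.1 ha).2 (Finset.mem_filter.1 hb).2

theorem blockCount_le_card (hx : IsRook x) (I J : Finset (Fin n)) : blockCount x I J ≤ I.card := by
  rw [blockCount_eq_sum_rows, Finset.card_eq_sum_ones]
  exact Finset.sum_le_sum fun i _ => hx.blockCount_singleton_le i J

theorem numNonzero_eq (hx : IsRook x) : numNonzero x = blockCount x Finset.univ Finset.univ := by
  rw [blockCount_eq_card, numNonzero]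
  have : {p : Fin n × Fin n | x p.1 p.2 ≠ 0} =
      {p | x p.1 p.2 = 1 ∧ p.1 ∈ Finset.univ ∧ p.2 ∈ Finset.univ} := by
    ext p
    rcases hx.1 p.1 p.2 with h | h <;> simp [h]
  rw [this]
  rfl

theorem numNonzero_submatrix (hx : IsRook x) (σ τ : Equiv.Perm (Fin n)) :
    numNonzero (x.submatrix σ τ) = numNonzero x := by
  rw [hx.numNonzero_eq, (hx.submatrix σ τ).numNonzero_eq, blockCount_submatrix]
  simp

theorem numNonzero_transpose (hx : IsRook x) : numNonzero x.transpose = numNonzero x := by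
  rw [hx.numNonzero_eq, hx.transpose.numNonzero_eq, blockCount_transpose]

end IsRook

/-- `x` has at least as many ones as `y` in each upper left block. -/
def RankLE (x y : Matrix (Fin n) (Fin n) K) : Prop :=
  ∀ I J : Finset (Fin n), IsLowerSet (I : Set (Fin n)) → IsLowerSet (J : Set (Fin n)) →
    blockCount y I J ≤ blockCount x I J

theorem RankLE.transpose {x y : Matrix (Fin n) (Fin n) K} (h : RankLE x y) :
    RankLE x.transpose y.transpose := fun I J hI hJ => by
  rw [blockCount_transpose, blockCount_transpose]
  exact h J I hJ hI

theorem RankLE.antisymm {x y : Matrix (Fin n) (Fin n) K} (hx : IsRook x) (hy : IsRook y)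
    (h : RankLE x y) (h' : RankLE y x) : x = y := by
  refine eq_of_blockCount_eq hx hy fun i j =>
    ⟨Finset.Iio i, Finset.Iio j, by simp, by simp, ?_, ?_, ?_, ?_⟩ <;>
  · apply le_antisymm
    · apply h' <;> intro a b hab ha <;> simp at ha ⊢ <;> grind
    · apply h <;> intro a b hab ha <;> simp at ha ⊢ <;> grind

/-- The one of row `i`, if any, comes weakly before the one of row `i'`, if any. -/
def RowLE (x : Matrix (Fin n) (Fin n) K) (i i' : Fin n) : Prop :=
  ∀ J : Finset (Fin n), IsLowerSet (J : Set (Fin n)) → blockCount x {i'} J ≤ blockCount x {i} J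

/-- Interchange of two rows. -/
abbrev swapRow (x : Matrix (Fin n) (Fin n) K) (i i' : Fin n) : Matrix (Fin n) (Fin n) K :=
  x.submatrix (Equiv.swap i i') id

/-- Interchange of two columns. -/
abbrev swapCol (x : Matrix (Fin n) (Fin n) K) (i i' : Fin n) : Matrix (Fin n) (Fin n) K :=
  x.submatrix id (Equiv.swap i i')

/-- On the chain of lower sets, the count of a row is a step function with values 0 and 1, and two
such functions are always comparable. -/
theorem IsRook.rowLE_total {x : Matrix (Fin n) (Fin n) K} (hx : IsRook x) (i i' : Fin n) :
    RowLE x i i' ∨ RowLE x i' i := by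
  by_contra hcon
  simp only [RowLE, not_or, not_forall, not_le] at hcon
  obtain ⟨⟨J, hJ, h⟩, ⟨J', hJ', h'⟩⟩ := hcon
  have h1 := hx.blockCount_singleton_le i
  have h2 := hx.blockCount_singleton_le i'
  rcases hJ.total hJ' with hs | hs
  · have := blockCount_mono x (le_refl {i'}) (Finset.coe_subset.1 hs)
    have := h1 J'
    omega
  · have := blockCount_mono x (le_refl {i}) (Finset.coe_subset.1 hs)
    have := h2 J
    omega

theorem RowLE.trans {x : Matrix (Fin n) (Fin n) K} {i j k : Fin n} (h : RowLE x i j)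
    (h' : RowLE x j k) : RowLE x i k := fun J hJ => (h' J hJ).trans (h J hJ)

/-- A lower set is either fixed by an adjacent transposition or cuts between its two points. -/
theorem map_swap_of_isLowerSet {i i' : Fin n} (hi : i ⋖ i') {I : Finset (Fin n)}
    (hI : IsLowerSet (I : Set (Fin n))) :
    I.map (Equiv.swap i i').toEmbedding = I ∨
      ∃ I₀ : Finset (Fin n), IsLowerSet (I₀ : Set (Fin n)) ∧ i ∉ I₀ ∧ i' ∉ insert i I₀ ∧
        I = insert i I₀ ∧ IsLowerSet ((insert i' (insert i I₀) : Finset (Fin n)) : Set (Fin n)) ∧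
        I.map (Equiv.swap i i').toEmbedding = insert i' I₀ := by
  have hlow : ∀ a b, b ≤ a → a ∈ I → b ∈ I := fun a b h ha => hI h ha
  have hlt := hi.lt
  have hadj : ∀ a, a < i' → a ≤ i := fun a ha => not_lt.1 fun h => hi.2 h ha
  by_cases h' : i' ∈ I
  · left
    have h := hlow _ _ hlt.le h'
    ext a
    simp only [Finset.mem_map_equiv, Equiv.symm_swap]
    rcases eq_or_ne a i with rfl | h1
    · simp [h, h']
    rcases eq_or_ne a i' with rfl | h2
    · simp [h, h']
    rw [Equiv.swap_apply_of_ne_of_ne h1 h2]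
  by_cases h : i ∈ I
  · right
    refine ⟨I.erase i, ?_, by simp, ?_, by simp [h], ?_, ?_⟩
    · intro a b hab ha
      simp only [Finset.coe_erase, Set.mem_sdiff, Finset.mem_coe, Set.mem_singleton_iff] at ha ⊢
      refine ⟨hlow _ _ hab ha.1, ?_⟩
      rintro rfl
      have h1 : i' ≤ a := not_lt.1 fun hlt' => ha.2 (le_antisymm (hadj a hlt') hab)
      exact h' (hlow _ _ h1 ha.1)
    · simp [h, h']
    · intro a b hab ha
      simp only [Finset.insert_erase h, Finset.coe_insert, Set.mem_insert_iff,
        Finset.mem_coe] at ha ⊢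
      rcases ha with rfl | ha
      · rcases hab.lt_or_eq with hb | hb
        · exact Or.inr (hlow _ _ (hadj b hb) h)
        · exact Or.inl hb
      · exact Or.inr (hlow _ _ hab ha)
    · ext a
      simp only [Finset.mem_map_equiv, Equiv.symm_swap, Finset.mem_insert, Finset.mem_erase]
      rcases eq_or_ne a i with rfl | h1
      · simp [h', hlt.ne]
      rcases eq_or_ne a i' with rfl | h2
      · simp [h]
      rw [Equiv.swap_apply_of_ne_of_ne h1 h2]
      simp [h1, h2]
  · left
    ext a
    simp only [Finset.mem_map_equiv, Equiv.symm_swap]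
    rcases eq_or_ne a i with rfl | h1
    · simp [h, h']
    rcases eq_or_ne a i' with rfl | h2
    · simp [h, h']
    rw [Equiv.swap_apply_of_ne_of_ne h1 h2]

theorem blockCount_swapRow (x : Matrix (Fin n) (Fin n) K) (i i' : Fin n)
    (I J : Finset (Fin n)) :
    blockCount (swapRow x i i') I J = blockCount x (I.map (Equiv.swap i i').toEmbedding) J := by
  have := blockCount_submatrix x (Equiv.swap i i') (Equiv.refl _) I J
  simpa using this

/-! ### Ascents, descents and lifting for interchanges of adjacent rows or columns. -/

section Lift

variable {x y : Matrix (Fin n) (Fin n) K} {i i' : Fin n}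

theorem RowLE.rankLE_swapRow (hi : i ⋖ i') (h : RowLE x i i') : RankLE x (swapRow x i i') := by
  intro I J hI hJ
  rw [blockCount_swapRow]
  rcases map_swap_of_isLowerSet hi hI with e | ⟨I₀, -, h1, h2, rfl, -, e⟩
  · rw [e]
  · rw [Finset.mem_insert, not_or] at h2
    rw [e, blockCount_insert _ h1, blockCount_insert _ h2.2]
    have := h J hJ
    omega

theorem RowLE.swapRow_rankLE (hi : i ⋖ i') (h : RowLE x i' i) : RankLE (swapRow x i i') x := by
  intro I J hI hJ
  rw [blockCount_swapRow]
  rcases map_swap_of_isLowerSet hi hI with e | ⟨I₀, -, h1, h2, rfl, -, e⟩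
  · rw [e]
  · rw [Finset.mem_insert, not_or] at h2
    rw [e, blockCount_insert _ h1, blockCount_insert _ h2.2]
    have := h J hJ
    omega

/-- The lifting property of the rank order, for interchanges of adjacent rows. -/
theorem RankLE.lift_swapRow (hx : IsRook x) (hy : IsRook y) (hi : i ⋖ i') (hxy : RankLE x y)
    (hxi : RowLE x i i') (hyi : RowLE y i' i) :
    RankLE x (swapRow y i i') ∧ RankLE (swapRow x i i') y := by
  have key : ∀ I J : Finset (Fin n), IsLowerSet (I : Set (Fin n)) →
      IsLowerSet (J : Set (Fin n)) →
      blockCount (swapRow y i i') I J ≤ blockCount x I J ∧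
        blockCount y I J ≤ blockCount (swapRow x i i') I J := by
    intro I J hI hJ
    rw [blockCount_swapRow, blockCount_swapRow]
    rcases map_swap_of_isLowerSet hi hI with e | ⟨I₀, hI₀, h1, h2, rfl, hI', e⟩
    · rw [e]
      exact ⟨hxy I J hI hJ, hxy I J hI hJ⟩
    -- Only the cut between `i` and `i'` matters. If row `i` of `x` contributes 1, or row `i` of `y`
    -- contributes 0, the inequality for `I₀` suffices for the respective claim. Otherwise the
    -- second row contributes the same as the first, and the inequality for both rows together gives
    -- the claim.
    · have a1 := hxy _ _ hI₀ hJ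
      have a2 := hxy _ _ hI hJ
      have a3 := hxy _ _ hI' hJ
      have h3 : i' ∉ I₀ := fun h => h2 (Finset.mem_insert_of_mem h)
      rw [e]
      rw [blockCount_insert _ h2, blockCount_insert _ h2] at a3
      rw [blockCount_insert _ h1, blockCount_insert _ h1] at a2 a3
      rw [blockCount_insert _ h1, blockCount_insert _ h1, blockCount_insert _ h3,
        blockCount_insert _ h3]
      have b1 := hxi J hJ
      have b2 := hyi J hJ
      have c1 := hx.blockCount_singleton_le i J
      have c2 := hx.blockCount_singleton_le i' J
      have c3 := hy.blockCount_singleton_le i J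
      have c4 := hy.blockCount_singleton_le i' J
      omega
  exact ⟨fun I J hI hJ => (key I J hI hJ).1, fun I J hI hJ => (key I J hI hJ).2⟩

theorem RowLE.rankLE_swapCol (hi : i ⋖ i') (h : RowLE x.transpose i i') :
    RankLE x (swapCol x i i') :=
  (h.rankLE_swapRow hi).transpose

theorem RowLE.swapCol_rankLE (hi : i ⋖ i') (h : RowLE x.transpose i' i) :
    RankLE (swapCol x i i') x :=
  (h.swapRow_rankLE hi).transpose

theorem RankLE.lift_swapCol (hx : IsRook x) (hy : IsRook y) (hi : i ⋖ i') (hxy : RankLE x y)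
    (hxi : RowLE x.transpose i i') (hyi : RowLE y.transpose i' i) :
    RankLE x (swapCol y i i') ∧ RankLE (swapCol x i i') y :=
  (hxy.transpose.lift_swapRow hx.transpose hy.transpose hi hxi hyi).imp
    RankLE.transpose RankLE.transpose

/-- Two equal rows of a rook matrix are both empty, which leaves at most `n - 2` ones. This is the
only source of the restriction `k ≥ n - 1`. -/
theorem IsRook.swapRow_ne (hx : IsRook x) (hi : i ≠ i') (hn : n ≤ numNonzero x + 1) :
    swapRow x i i' ≠ x := by
  intro h
  have hrow : ∀ j, x i' j = x i j := fun j => by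
    have := congrFun (congrFun h i) j
    simpa using this
  have h0 : blockCount x {i} Finset.univ = 0 := by
    rw [blockCount_eq_zero]
    intro a ha j _ hj
    rw [Finset.mem_singleton] at ha
    subst ha
    exact hi (hx.2.2 _ _ j hj ((hrow j).trans hj))
  have h0' : blockCount x {i'} Finset.univ = 0 := by
    rw [blockCount_eq_zero] at h0 ⊢
    intro a ha j hj
    rw [Finset.mem_singleton] at ha
    subst ha
    rw [hrow j]
    exact h0 i (Finset.mem_singleton_self i) j hj
  have hcard := hx.blockCount_le_card ((Finset.univ.erase i).erase i') Finset.univ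
  have e1 : insert i (insert i' ((Finset.univ.erase i).erase i')) = Finset.univ := by
    rw [Finset.insert_erase (by simp [hi.symm]), Finset.insert_erase (by simp)]
  have e2 : ((Finset.univ.erase i).erase i').card + 2 = n := by
    have := congrArg Finset.card e1
    rw [Finset.card_insert_of_notMem (by simp [hi]), Finset.card_insert_of_notMem (by simp),
      Finset.card_univ, Fintype.card_fin] at this
    omega
  rw [hx.numNonzero_eq, ← e1, blockCount_insert _ (by simp [hi]), blockCount_insert _ (by simp),
    e1, h0, h0'] at hn
  omega

theorem IsRook.swapCol_ne (hx : IsRook x) (hi : i ≠ i') (hn : n ≤ numNonzero x + 1) :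
    swapCol x i i' ≠ x := fun h =>
  hx.transpose.swapRow_ne hi (by rwa [hx.numNonzero_transpose])
    (congrArg Matrix.transpose h)

end Lift

theorem rowLE_of_forall_covBy {x : Matrix (Fin n) (Fin n) K}
    (h : ∀ i i' : Fin n, i ⋖ i' → RowLE x i i') {i i' : Fin n} (hi : i ≤ i') : RowLE x i i' := by
  rw [le_iff_reflTransGen_covBy] at hi
  induction hi with
  | refl => exact fun _ _ => le_rfl
  | tail _ hc ih => exact ih.trans (h _ _ hc)

/-- Every row up to `i` has a one in the columns up to `j`, and distinct rows use distinct columns.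
-/
theorem IsRook.le_of_rowLE {x : Matrix (Fin n) (Fin n) K} (hx : IsRook x)
    (h : ∀ i i' : Fin n, i ⋖ i' → RowLE x i i') {i j : Fin n} (hij : x i j = 1) : i ≤ j := by
  have h1 : (Finset.Iic i).card ≤ blockCount x (Finset.Iic i) (Finset.Iic j) := by
    rw [blockCount_eq_sum_rows, Finset.card_eq_sum_ones]
    refine Finset.sum_le_sum fun a ha => ?_
    refine le_trans ?_ (rowLE_of_forall_covBy h (Finset.mem_Iic.1 ha) (Finset.Iic j) ?_)
    · exact blockCount_singleton_pos.2 ⟨j, by simp, hij⟩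
    · rw [Finset.coe_Iic]
      exact isLowerSet_Iic j
  have h2 := hx.transpose.blockCount_le_card (Finset.Iic j) (Finset.Iic i)
  rw [blockCount_transpose] at h2
  have := h1.trans h2
  simp only [Fin.card_Iic] at this
  exact Fin.le_def.2 (by omega)

/-- The rows and columns of a rook matrix being in increasing position determines it. -/
theorem IsRook.eq_of_rowLE {x y : Matrix (Fin n) (Fin n) K} (hx : IsRook x) (hy : IsRook y)
    (hxr : ∀ i i' : Fin n, i ⋖ i' → RowLE x i i')
    (hxc : ∀ i i' : Fin n, i ⋖ i' → RowLE x.transpose i i')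
    (hyr : ∀ i i' : Fin n, i ⋖ i' → RowLE y i i')
    (hyc : ∀ i i' : Fin n, i ⋖ i' → RowLE y.transpose i i')
    (hxy : numNonzero x = numNonzero y) : x = y := by
  have main : ∀ {x y : Matrix (Fin n) (Fin n) K}, IsRook x → IsRook y →
      (∀ i i' : Fin n, i ⋖ i' → RowLE x i i') →
      (∀ i i' : Fin n, i ⋖ i' → RowLE x.transpose i i') →
      (∀ i i' : Fin n, i ⋖ i' → RowLE y i i') →
      (∀ i i' : Fin n, i ⋖ i' → RowLE y.transpose i i') →
      numNonzero x = numNonzero y → ∀ i j, x i j = 1 → y i j = 1 := by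
    intro x y hx hy hxr hxc hyr hyc hxy i j hij
    -- Row and column conditions together put all ones on the diagonal. They then fill an initial
    -- segment, whose length is the number of ones.
    have : i = j := le_antisymm (hx.le_of_rowLE hxr hij) (hx.transpose.le_of_rowLE hxc hij)
    subst this
    by_contra hcon
    have hrow : ∀ a, i ≤ a → blockCount y {a} Finset.univ = 0 := by
      intro a ha
      have h0 : blockCount y {i} Finset.univ = 0 := by
        rw [blockCount_eq_zero]
        intro b hb j _ hj
        rw [Finset.mem_singleton] at hb
        subst hb
        have := le_antisymm (hy.le_of_rowLE hyr hj) (hy.transpose.le_of_rowLE hyc hj)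
        subst this
        exact hcon hj
      have := rowLE_of_forall_covBy hyr ha Finset.univ (by simpa using isLowerSet_univ)
      omega
    have h1 : blockCount y Finset.univ Finset.univ ≤ (Finset.Iio i).card := by
      rw [blockCount_eq_sum_rows, ← Finset.sum_subset (Finset.subset_univ (Finset.Iio i)),
        ← blockCount_eq_sum_rows]
      · exact hy.blockCount_le_card _ _
      · intro a _ ha
        exact hrow a (by simpa using ha)
    have h2 : (Finset.Iic i).card ≤ blockCount x Finset.univ Finset.univ := by
      refine le_trans ?_ (blockCount_mono x (Finset.subset_univ (Finset.Iic i)) le_rfl)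
      rw [blockCount_eq_sum_rows, Finset.card_eq_sum_ones]
      refine Finset.sum_le_sum fun a ha => ?_
      refine le_trans ?_ (rowLE_of_forall_covBy hxr (Finset.mem_Iic.1 ha) Finset.univ
        (by simpa using isLowerSet_univ))
      exact blockCount_singleton_pos.2 ⟨i, by simp, hij⟩
    rw [hx.numNonzero_eq, hy.numNonzero_eq] at hxy
    simp only [Fin.card_Iic, Fin.card_Iio] at h1 h2
    omega
  exact hx.ext hy fun i j => ⟨main hx hy hxr hxc hyr hyc hxy i j,
    main hy hx hyr hyc hxr hxc hxy.symm i j⟩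

end RankOrder

/-! ### Rook matrices ordered by rank conditions -/

/-- The rook matrices with exactly `k` ones, with the order `RankLE`. -/
def RankRook (n k : ℕ) (K : Type*) [Field K] : Type _ :=
  {x : Matrix (Fin n) (Fin n) K // IsRook x ∧ numNonzero x = k}

instance RankRook.instPartialOrder (n k : ℕ) (K : Type*) [Field K] :
    PartialOrder (RankRook n k K) where
  le x y := RankLE x.1 y.1
  le_refl _ _ _ _ _ := le_rfl
  le_trans _ _ _ h h' I J hI hJ := (h' I J hI hJ).trans (h I J hI hJ)
  le_antisymm x y h h' := Subtype.ext (RankLE.antisymm x.2.1 y.2.1 h h')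

theorem finite_isRook (n : ℕ) (K : Type*) [Field K] :
    Finite {x : Matrix (Fin n) (Fin n) K // IsRook x} := by
  classical
  refine Finite.of_injective (β := Fin n → Fin n → Bool) (fun x i j => decide (x.1 i j = 1))
    fun x y h => Subtype.ext (x.2.ext y.2 fun i j => ?_)
  have := congrFun (congrFun h i) j
  simpa using this

instance RankRook.instFinite (n k : ℕ) (K : Type*) [Field K] : Finite (RankRook n k K) :=
  have := finite_isRook n K
  Finite.of_injective (β := {x : Matrix (Fin n) (Fin n) K // IsRook x})
    (fun x => ⟨x.1, x.2.1⟩) fun _ _ h => Subtype.ext (Subtype.mk.inj h)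

/-- The symmetric rook matrices with exactly `k` ones, with the order `RankLE`. -/
abbrev SymmRankRook (n k : ℕ) (K : Type*) [Field K] : Type _ :=
  {x : RankRook n k K // x.1.IsSymm}

/-- Pairs of consecutive indices. -/
abbrev AdjacentPair (n : ℕ) : Type := {p : Fin n × Fin n // p.1 ⋖ p.2}

section Systems

variable {n k : ℕ} {K : Type*} [Field K]

/-! ### The lifting system on rook matrices. -/

namespace RankRook

/-- Permutation of the rows and columns. -/
def perm (σ τ : Equiv.Perm (Fin n)) (x : RankRook n k K) : RankRook n k K :=
  ⟨x.1.submatrix σ τ, x.2.1.submatrix σ τ, by rw [x.2.1.numNonzero_submatrix, x.2.2]⟩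

/-- Interchange of adjacent rows (on the left) or adjacent columns (on the right). -/
def swap : AdjacentPair n ⊕ AdjacentPair n → RankRook n k K → RankRook n k K
  | .inl p => perm (Equiv.swap p.1.1 p.1.2) (Equiv.refl _)
  | .inr p => perm (Equiv.refl _) (Equiv.swap p.1.1 p.1.2)

theorem le_iff {x y : RankRook n k K} : x ≤ y ↔ RankLE x.1 y.1 := Iff.rfl

theorem coe_swap_inl (p : AdjacentPair n) (x : RankRook n k K) :
    (swap (.inl p) x).1 = swapRow x.1 p.1.1 p.1.2 := rfl

theorem coe_swap_inr (p : AdjacentPair n) (x : RankRook n k K) :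
    (swap (.inr p) x).1 = swapCol x.1 p.1.1 p.1.2 := rfl

theorem le_swap_inl {p : AdjacentPair n} {x : RankRook n k K} (h : RowLE x.1 p.1.1 p.1.2) :
    x ≤ swap (.inl p) x := by
  rw [le_iff, coe_swap_inl]
  exact h.rankLE_swapRow p.2

theorem swap_inl_le {p : AdjacentPair n} {x : RankRook n k K} (h : RowLE x.1 p.1.2 p.1.1) :
    swap (.inl p) x ≤ x := by
  rw [le_iff, coe_swap_inl]
  exact h.swapRow_rankLE p.2

theorem le_swap_inr {p : AdjacentPair n} {x : RankRook n k K}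
    (h : RowLE x.1.transpose p.1.1 p.1.2) : x ≤ swap (.inr p) x := by
  rw [le_iff, coe_swap_inr]
  exact h.rankLE_swapCol p.2

theorem swap_inr_le {p : AdjacentPair n} {x : RankRook n k K}
    (h : RowLE x.1.transpose p.1.2 p.1.1) : swap (.inr p) x ≤ x := by
  rw [le_iff, coe_swap_inr]
  exact h.swapCol_rankLE p.2

theorem swap_ne (hk : n ≤ k + 1) (s : AdjacentPair n ⊕ AdjacentPair n) (x : RankRook n k K) :
    swap s x ≠ x := by
  have hnum : n ≤ numNonzero x.1 + 1 := by rwa [x.2.2]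
  intro h
  have h' := congrArg Subtype.val h
  rcases s with p | p
  · rw [coe_swap_inl] at h'
    exact x.2.1.swapRow_ne p.2.lt.ne hnum h'
  · rw [coe_swap_inr] at h'
    exact x.2.1.swapCol_ne p.2.lt.ne hnum h'

theorem rowLE_of_le_swap_inl (hk : n ≤ k + 1) {p : AdjacentPair n} {x : RankRook n k K}
    (h : x ≤ swap (.inl p) x) : RowLE x.1 p.1.1 p.1.2 :=
  (x.2.1.rowLE_total _ _).resolve_right fun h' =>
    swap_ne hk _ _ (le_antisymm (swap_inl_le h') h)

theorem rowLE_of_swap_inl_le (hk : n ≤ k + 1) {p : AdjacentPair n} {x : RankRook n k K}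
    (h : swap (.inl p) x ≤ x) : RowLE x.1 p.1.2 p.1.1 :=
  (x.2.1.rowLE_total _ _).resolve_left fun h' =>
    swap_ne hk _ _ (le_antisymm h (le_swap_inl h'))

theorem rowLE_of_le_swap_inr (hk : n ≤ k + 1) {p : AdjacentPair n} {x : RankRook n k K}
    (h : x ≤ swap (.inr p) x) : RowLE x.1.transpose p.1.1 p.1.2 :=
  (x.2.1.transpose.rowLE_total _ _).resolve_right fun h' =>
    swap_ne hk _ _ (le_antisymm (swap_inr_le h') h)

theorem rowLE_of_swap_inr_le (hk : n ≤ k + 1) {p : AdjacentPair n} {x : RankRook n k K}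
    (h : swap (.inr p) x ≤ x) : RowLE x.1.transpose p.1.2 p.1.1 :=
  (x.2.1.transpose.rowLE_total _ _).resolve_left fun h' =>
    swap_ne hk _ _ (le_antisymm h (le_swap_inr h'))

theorem isLiftingSystem_swap (hk : n ≤ k + 1) :
    IsLiftingSystem (swap : AdjacentPair n ⊕ AdjacentPair n → RankRook n k K → _) := by
  refine ⟨?_, swap_ne hk, ?_, ?_, ?_⟩
  · rintro (p | p) x <;>
    · apply Subtype.ext
      ext i j
      simp [swap, perm]
  · rintro (p | p) x
    · exact (x.2.1.rowLE_total p.1.2 p.1.1).imp swap_inl_le le_swap_inl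
    · exact (x.2.1.transpose.rowLE_total p.1.2 p.1.1).imp swap_inr_le le_swap_inr
  · rintro (p | p) x y hxy hy hx
    · rw [le_iff, le_iff, coe_swap_inl, coe_swap_inl]
      exact RankLE.lift_swapRow x.2.1 y.2.1 p.2 hxy (rowLE_of_le_swap_inl hk hx)
        (rowLE_of_swap_inl_le hk hy)
    · rw [le_iff, le_iff, coe_swap_inr, coe_swap_inr]
      exact RankLE.lift_swapCol x.2.1 y.2.1 p.2 hxy (rowLE_of_le_swap_inr hk hx)
        (rowLE_of_swap_inr_le hk hy)
  · intro x y hx hy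
    exact Subtype.ext (x.2.1.eq_of_rowLE y.2.1
      (fun i i' h => rowLE_of_le_swap_inl hk (hx (.inl ⟨(i, i'), h⟩)))
      (fun i i' h => rowLE_of_le_swap_inr hk (hx (.inr ⟨(i, i'), h⟩)))
      (fun i i' h => rowLE_of_le_swap_inl hk (hy (.inl ⟨(i, i'), h⟩)))
      (fun i i' h => rowLE_of_le_swap_inr hk (hy (.inr ⟨(i, i'), h⟩)))
      (x.2.2.trans y.2.2.symm))

end RankRook

/-! ### Conjugation by an adjacent transposition. -/

section Conj

variable {x : Matrix (Fin n) (Fin n) K} {i i' : Fin n}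

/-- Simultaneous interchange of two rows and of the corresponding columns. -/
abbrev swapBoth (x : Matrix (Fin n) (Fin n) K) (i i' : Fin n) : Matrix (Fin n) (Fin n) K :=
  x.submatrix (Equiv.swap i i') (Equiv.swap i i')

/-- When the ones of these two rows and two columns all lie in the common 2×2 block, the interchange
affects only that block. -/
theorem IsRook.swapBoth_eq_of_block (hx : IsRook x)
    (h : ∀ a b, (a = i ∨ a = i') → (b = i ∨ b = i') →
      x (Equiv.swap i i' a) (Equiv.swap i i' b) = x a b)
    (hr : ∀ a, (a = i ∨ a = i') → ∃ b, (b = i ∨ b = i') ∧ x a b = 1)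
    (hc : ∀ b, (b = i ∨ b = i') → ∃ a, (a = i ∨ a = i') ∧ x a b = 1) :
    swapBoth x i i' = x := by
  have hz : ∀ a b, (a = i ∨ a = i') → ¬ (b = i ∨ b = i') → x a b = 0 := by
    intro a b ha hb
    obtain ⟨c, hc, hac⟩ := hr a ha
    exact (hx.1 a b).resolve_right fun hab => hb (hx.2.1 _ _ _ hac hab ▸ hc)
  have hz' : ∀ a b, ¬ (a = i ∨ a = i') → (b = i ∨ b = i') → x a b = 0 := by
    intro a b ha hb
    obtain ⟨c, hc, hac⟩ := hc b hb
    exact (hx.1 a b).resolve_right fun hab => ha (hx.2.2 _ _ _ hac hab ▸ hc)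
  have hs : ∀ a, (a = i ∨ a = i') → (Equiv.swap i i' a = i ∨ Equiv.swap i i' a = i') := by
    rintro a (rfl | rfl) <;> simp
  have hs' : ∀ a, ¬ (a = i ∨ a = i') → Equiv.swap i i' a = a := fun a ha =>
    Equiv.swap_apply_of_ne_of_ne (fun h => ha (Or.inl h)) fun h => ha (Or.inr h)
  ext a b
  change x (Equiv.swap i i' a) (Equiv.swap i i' b) = x a b
  by_cases ha : a = i ∨ a = i' <;> by_cases hb : b = i ∨ b = i'
  · exact h a b ha hb
  · rw [hs' b hb, hz _ _ (hs a ha) hb, hz _ _ ha hb]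
  · rw [hs' a ha, hz' _ _ ha (hs b hb), hz' _ _ ha hb]
  · rw [hs' a ha, hs' b hb]

theorem IsRook.swapBoth_eq_of_diag (hx : IsRook x) (h : x i i = 1) (h' : x i' i' = 1) :
    swapBoth x i i' = x := by
  refine hx.swapBoth_eq_of_block ?_ ?_ ?_
  · have h1 : i ≠ i' → x i i' = 0 := fun hne =>
      (hx.1 i i').resolve_right fun e => hne (hx.2.1 _ _ _ h e)
    have h2 : i ≠ i' → x i' i = 0 := fun hne =>
      (hx.1 i' i).resolve_right fun e => hne (hx.2.1 _ _ _ e h')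
    rcases eq_or_ne i i' with rfl | hne
    · simp
    rintro a b (rfl | rfl) (rfl | rfl) <;> simp [h, h', h1 hne, h2 hne]
  · rintro a (rfl | rfl)
    exacts [⟨a, Or.inl rfl, h⟩, ⟨a, Or.inr rfl, h'⟩]
  · rintro a (rfl | rfl)
    exacts [⟨a, Or.inl rfl, h⟩, ⟨a, Or.inr rfl, h'⟩]

theorem IsRook.swapBoth_eq_of_antidiag (hx : IsRook x) (h : x i i' = 1) (h' : x i' i = 1) :
    swapBoth x i i' = x := by
  refine hx.swapBoth_eq_of_block ?_ ?_ ?_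
  · have h1 : i ≠ i' → x i i = 0 := fun hne =>
      (hx.1 i i).resolve_right fun e => hne (hx.2.1 _ _ _ e h)
    have h2 : i ≠ i' → x i' i' = 0 := fun hne =>
      (hx.1 i' i').resolve_right fun e => hne (hx.2.1 _ _ _ h' e)
    rcases eq_or_ne i i' with rfl | hne
    · simp
    rintro a b (rfl | rfl) (rfl | rfl) <;> simp [h, h', h1 hne, h2 hne]
  · rintro a (rfl | rfl)
    exacts [⟨i', Or.inr rfl, h⟩, ⟨i, Or.inl rfl, h'⟩]
  · rintro a (rfl | rfl)
    exacts [⟨i', Or.inr rfl, h'⟩, ⟨i, Or.inl rfl, h⟩]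

theorem blockCount_insert_col (x : Matrix (Fin n) (Fin n) K) {j : Fin n} (I : Finset (Fin n))
    {J : Finset (Fin n)} (hj : j ∉ J) :
    blockCount x I (insert j J) = blockCount x I {j} + blockCount x I J := by
  simp only [← blockCount_transpose x, blockCount_insert _ hj]

theorem blockCount_swapCol (x : Matrix (Fin n) (Fin n) K) (i i' : Fin n)
    (I J : Finset (Fin n)) :
    blockCount (swapCol x i i') I J = blockCount x I (J.map (Equiv.swap i i').toEmbedding) := by
  have := blockCount_submatrix x (Equiv.refl _) (Equiv.swap i i') I J
  simpa using this

/-- Rows of a rook matrix keep their relative position when the corresponding columns are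
interchanged, unless the double interchange fixes the matrix. -/
theorem RowLE.rowLE_swapCol (hx : IsRook x) (hi : i ⋖ i') (h : RowLE x i i')
    (hne : swapBoth x i i' ≠ x) : RowLE (swapCol x i i') i i' := by
  intro J hJ
  rw [blockCount_swapCol, blockCount_swapCol]
  rcases map_swap_of_isLowerSet hi hJ with e | ⟨J₀, hJ₀, h1, h2, rfl, hJ', e⟩
  · rw [e]
    exact h J hJ
  · have h3 : i' ∉ J₀ := fun h => h2 (Finset.mem_insert_of_mem h)
    have a1 := h _ hJ₀
    have a3 := h _ hJ'
    have c1 := hx.blockCount_singleton_le i' (insert i' J₀)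
    rw [e]
    rw [blockCount_insert_col _ _ h2, blockCount_insert_col _ _ h2,
      blockCount_insert_col _ _ h1, blockCount_insert_col _ _ h1] at a3
    rw [blockCount_insert_col _ _ h3] at c1 ⊢
    rw [blockCount_insert_col _ _ h3]
    by_contra hcon
    have h4 : x i' i' = 1 := blockCount_singleton_singleton.1 (by omega)
    have h5 : x i i = 1 := blockCount_singleton_singleton.1 (by omega)
    exact hne (hx.swapBoth_eq_of_diag h5 h4)

/-- The relative position can fail only if `x i i' = 1`. Symmetry then makes the block antidiagonal,
and conjugation fixes `x`. -/
theorem RowLE.rowLE_swapCol' (hx : IsRook x) (hsymm : x.IsSymm) (hi : i ⋖ i') (h : RowLE x i' i)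
    (hne : swapBoth x i i' ≠ x) : RowLE (swapCol x i i') i' i := by
  intro J hJ
  rw [blockCount_swapCol, blockCount_swapCol]
  rcases map_swap_of_isLowerSet hi hJ with e | ⟨J₀, hJ₀, h1, h2, rfl, hJ', e⟩
  · rw [e]
    exact h J hJ
  · have h3 : i' ∉ J₀ := fun h => h2 (Finset.mem_insert_of_mem h)
    have a1 := h _ hJ₀
    have c1 := hx.blockCount_singleton_le i (insert i' J₀)
    rw [e]
    rw [blockCount_insert_col _ _ h3] at c1 ⊢
    rw [blockCount_insert_col _ _ h3]
    by_contra hcon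
    have h4 : x i i' = 1 := blockCount_singleton_singleton.1 (by omega)
    exact hne (hx.swapBoth_eq_of_antidiag h4 (by rw [← hsymm.apply, h4]))

end Conj

/-! ### The lifting system on symmetric rook matrices. -/

namespace SymmRankRook

open Classical in
/-- Conjugation by an adjacent transposition, or multiplication by it if conjugation acts
trivially. -/
noncomputable def swap (p : AdjacentPair n) (x : SymmRankRook n k K) : SymmRankRook n k K :=
  if h : swapBoth x.1.1 p.1.1 p.1.2 = x.1.1 then
    ⟨RankRook.perm (Equiv.refl _) (Equiv.swap p.1.1 p.1.2) x.1, by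
      have hs := x.2
      ext a b
      have h1 := congrFun (congrFun h b) (Equiv.swap p.1.1 p.1.2 a)
      have h2 := hs.apply b (Equiv.swap p.1.1 p.1.2 a)
      simp only [Matrix.submatrix_apply, Equiv.swap_apply_self, RankRook.perm,
        Matrix.transpose_apply, Equiv.refl_apply] at h1 h2 ⊢
      rw [← h1, hs.apply]⟩
  else ⟨RankRook.perm (Equiv.swap p.1.1 p.1.2) (Equiv.swap p.1.1 p.1.2) x.1, x.2.submatrix _⟩

theorem coe_swap_of_eq {p : AdjacentPair n} {x : SymmRankRook n k K}
    (h : swapBoth x.1.1 p.1.1 p.1.2 = x.1.1) :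
    (swap p x).1.1 = swapCol x.1.1 p.1.1 p.1.2 := by
  rw [swap, dif_pos h]
  rfl

theorem coe_swap_of_ne {p : AdjacentPair n} {x : SymmRankRook n k K}
    (h : swapBoth x.1.1 p.1.1 p.1.2 ≠ x.1.1) :
    (swap p x).1.1 = swapBoth x.1.1 p.1.1 p.1.2 := by
  rw [swap, dif_neg h]
  rfl

theorem rowLE_transpose {x : SymmRankRook n k K} {i i' : Fin n} (h : RowLE x.1.1 i i') :
    RowLE x.1.1.transpose i i' := by
  rwa [x.2.eq]

/-- Nontrivial conjugation is a column interchange followed by a row interchange. The first does not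
destroy the position of the rows, so both go up. -/
theorem le_swap {p : AdjacentPair n} {x : SymmRankRook n k K} (h : RowLE x.1.1 p.1.1 p.1.2) :
    x ≤ swap p x := by
  have h1 := (rowLE_transpose h).rankLE_swapCol p.2
  change RankLE _ _
  by_cases hx : swapBoth x.1.1 p.1.1 p.1.2 = x.1.1
  · rwa [coe_swap_of_eq hx]
  · rw [coe_swap_of_ne hx]
    have h2 := (h.rowLE_swapCol x.1.2.1 p.2 hx).rankLE_swapRow p.2
    exact fun I J hI hJ => (h2 I J hI hJ).trans (h1 I J hI hJ)

theorem swap_le {p : AdjacentPair n} {x : SymmRankRook n k K} (h : RowLE x.1.1 p.1.2 p.1.1) :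
    swap p x ≤ x := by
  have h1 := (rowLE_transpose h).swapCol_rankLE p.2
  change RankLE _ _
  by_cases hx : swapBoth x.1.1 p.1.1 p.1.2 = x.1.1
  · rwa [coe_swap_of_eq hx]
  · rw [coe_swap_of_ne hx]
    have h2 := (h.rowLE_swapCol' x.1.2.1 x.2 p.2 hx).swapRow_rankLE p.2
    exact fun I J hI hJ => (h1 I J hI hJ).trans (h2 I J hI hJ)

theorem swap_ne (hk : n ≤ k + 1) (p : AdjacentPair n) (x : SymmRankRook n k K) :
    swap p x ≠ x := by
  intro h
  have h' : (swap p x).1.1 = x.1.1 := by rw [h]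
  by_cases hx : swapBoth x.1.1 p.1.1 p.1.2 = x.1.1
  · rw [coe_swap_of_eq hx] at h'
    exact x.1.2.1.swapCol_ne p.2.lt.ne (by rwa [x.1.2.2]) h'
  · rw [coe_swap_of_ne hx] at h'
    exact hx h'

theorem rowLE_of_le_swap (hk : n ≤ k + 1) {p : AdjacentPair n} {x : SymmRankRook n k K}
    (h : x ≤ swap p x) : RowLE x.1.1 p.1.1 p.1.2 :=
  (x.1.2.1.rowLE_total _ _).resolve_right fun h' =>
    swap_ne hk _ _ (le_antisymm (swap_le h') h)

theorem rowLE_of_swap_le (hk : n ≤ k + 1) {p : AdjacentPair n} {x : SymmRankRook n k K}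
    (h : swap p x ≤ x) : RowLE x.1.1 p.1.2 p.1.1 :=
  (x.1.2.1.rowLE_total _ _).resolve_left fun h' =>
    swap_ne hk _ _ (le_antisymm h (le_swap h'))

theorem isLiftingSystem_swap (hk : n ≤ k + 1) :
    IsLiftingSystem (swap : AdjacentPair n → SymmRankRook n k K → _) := by
  refine ⟨?_, swap_ne hk, ?_, ?_, ?_⟩
  · intro p x
    apply Subtype.ext
    apply Subtype.ext
    by_cases hx : swapBoth x.1.1 p.1.1 p.1.2 = x.1.1
    · have h1 : swapBoth (swap p x).1.1 p.1.1 p.1.2 = (swap p x).1.1 := by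
        rw [coe_swap_of_eq hx]
        ext a b
        have := congrFun (congrFun hx a) (Equiv.swap p.1.1 p.1.2 b)
        simpa using this
      rw [coe_swap_of_eq h1, coe_swap_of_eq hx]
      ext a b
      simp
    · have h1 : swapBoth (swap p x).1.1 p.1.1 p.1.2 = x.1.1 := by
        rw [coe_swap_of_ne hx]
        ext a b
        simp
      rw [coe_swap_of_ne, h1]
      rw [h1, coe_swap_of_ne hx]
      exact fun h => hx h.symm
  · intro p x
    exact (x.1.2.1.rowLE_total p.1.2 p.1.1).imp swap_le le_swap
  · intro p x y hxy hy hx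
    have hx' := rowLE_of_le_swap hk hx
    have hy' := rowLE_of_swap_le hk hy
    -- Lifting is done one side at a time. The column lift suffices when conjugation is trivial;
    -- otherwise the relative row positions survive it and the row lift can follow.
    have h1 := RankLE.lift_swapCol x.1.2.1 y.1.2.1 p.2 hxy (rowLE_transpose hx')
      (rowLE_transpose hy')
    constructor
    · change RankLE _ _
      by_cases hs : swapBoth y.1.1 p.1.1 p.1.2 = y.1.1
      · rw [coe_swap_of_eq hs]
        exact h1.1
      · rw [coe_swap_of_ne hs]
        exact (RankLE.lift_swapRow x.1.2.1 (y.1.2.1.submatrix (Equiv.refl _) _) p.2 h1.1 hx'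
          (hy'.rowLE_swapCol' y.1.2.1 y.2 p.2 hs)).1
    · change RankLE _ _
      by_cases hs : swapBoth x.1.1 p.1.1 p.1.2 = x.1.1
      · rw [coe_swap_of_eq hs]
        exact h1.2
      · rw [coe_swap_of_ne hs]
        exact (RankLE.lift_swapRow (x.1.2.1.submatrix (Equiv.refl _) _) y.1.2.1 p.2 h1.2
          (hx'.rowLE_swapCol x.1.2.1 p.2 hs) hy').2
  · intro x y hx hy
    exact Subtype.ext (Subtype.ext (x.1.2.1.eq_of_rowLE y.1.2.1
      (fun i i' h => rowLE_of_le_swap hk (hx ⟨(i, i'), h⟩))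
      (fun i i' h => rowLE_transpose (rowLE_of_le_swap hk (hx ⟨(i, i'), h⟩)))
      (fun i i' h => rowLE_of_le_swap hk (hy ⟨(i, i'), h⟩))
      (fun i i' h => rowLE_transpose (rowLE_of_le_swap hk (hy ⟨(i, i'), h⟩)))
      (x.1.2.2.trans y.1.2.2.symm)))

end SymmRankRook

end Systems

/-! ### Zariski closures and polynomial maps -/

section Closure

open MvPolynomial

variable {n : ℕ} {K : Type*} [Field K]

/-- Polynomial maps are continuous for the Zariski topology: an equation of the target is pulled
back by substituting the entries of `P`. -/
theorem map_mem_zariskiClosure {S T : Set (Matrix (Fin n) (Fin n) K)}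
    {F : Matrix (Fin n) (Fin n) K → Matrix (Fin n) (Fin n) K}
    (P : Matrix (Fin n) (Fin n) (MvPolynomial (Fin n × Fin n) K))
    (hP : ∀ Y : Matrix (Fin n) (Fin n) K,
      P.map (eval fun q : Fin n × Fin n => Y q.1 q.2) = F Y)
    (hF : ∀ Y ∈ S, F Y ∈ zariskiClosure T) {X : Matrix (Fin n) (Fin n) K}
    (hX : X ∈ zariskiClosure S) : F X ∈ zariskiClosure T := by
  have key : ∀ (Y : Matrix (Fin n) (Fin n) K) (p : MvPolynomial (Fin n × Fin n) K),
      eval (fun q : Fin n × Fin n => Y q.1 q.2) (bind₁ (fun q : Fin n × Fin n => P q.1 q.2) p) =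
        eval (fun q : Fin n × Fin n => F Y q.1 q.2) p := by
    intro Y p
    rw [eval, eval₂Hom_bind₁]
    congr 2
    funext q
    exact congrFun (congrFun (hP Y) q.1) q.2
  rw [mem_zariskiClosure_iff] at hX ⊢
  intro p hp
  rw [← key]
  refine hX _ fun Y hY => ?_
  rw [key]
  exact mem_zariskiClosure_iff.1 (hF Y hY) p hp

theorem mvPolynomialX_map_eval (Y : Matrix (Fin n) (Fin n) K) :
    (Matrix.mvPolynomialX (Fin n) (Fin n) K).map (eval fun q : Fin n × Fin n => Y q.1 q.2) = Y := by
  ext i j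
  simp [Matrix.mvPolynomialX]

theorem map_C_map_eval (A Y : Matrix (Fin n) (Fin n) K) :
    (A.map (C : K →+* MvPolynomial (Fin n × Fin n) K)).map
      (eval fun q : Fin n × Fin n => Y q.1 q.2) = A := by
  ext i j
  simp

theorem mul_mul_mem_zariskiClosure {S T : Set (Matrix (Fin n) (Fin n) K)}
    (A B : Matrix (Fin n) (Fin n) K) (h : ∀ Y ∈ S, A * Y * B ∈ zariskiClosure T)
    {X : Matrix (Fin n) (Fin n) K} (hX : X ∈ zariskiClosure S) :
    A * X * B ∈ zariskiClosure T := by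
  refine map_mem_zariskiClosure (F := fun Y => A * Y * B)
    (A.map (C : K →+* _) * Matrix.mvPolynomialX (Fin n) (Fin n) K * B.map (C : K →+* _))
    (fun Y => ?_) h hX
  rw [Matrix.map_mul, Matrix.map_mul, map_C_map_eval, map_C_map_eval, mvPolynomialX_map_eval]

theorem transpose_mem_zariskiClosure {S T : Set (Matrix (Fin n) (Fin n) K)}
    (h : ∀ Y ∈ S, Y.transpose ∈ zariskiClosure T)
    {X : Matrix (Fin n) (Fin n) K} (hX : X ∈ zariskiClosure S) :
    X.transpose ∈ zariskiClosure T :=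
  map_mem_zariskiClosure (F := Matrix.transpose)
    (Matrix.mvPolynomialX (Fin n) (Fin n) K).transpose
    (fun Y => by rw [Matrix.transpose_map, mvPolynomialX_map_eval]) h hX

theorem transpose_mul_mul_mem_zariskiClosure {S T : Set (Matrix (Fin n) (Fin n) K)}
    (x : Matrix (Fin n) (Fin n) K) (h : ∀ Y ∈ S, Y.transpose * x * Y ∈ zariskiClosure T)
    {X : Matrix (Fin n) (Fin n) K} (hX : X ∈ zariskiClosure S) :
    X.transpose * x * X ∈ zariskiClosure T := by
  refine map_mem_zariskiClosure (F := fun Y => Y.transpose * x * Y)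
    ((Matrix.mvPolynomialX (Fin n) (Fin n) K).transpose * x.map (C : K →+* _) *
      Matrix.mvPolynomialX (Fin n) (Fin n) K)
    (fun Y => ?_) h hX
  rw [Matrix.map_mul, Matrix.map_mul, Matrix.transpose_map, map_C_map_eval,
    mvPolynomialX_map_eval]

end Closure

/-! ### Minimal parabolic subgroups -/

section Parabolic

variable {n : ℕ} {K : Type*} [Field K]

/-- Matrices whose entries below the diagonal vanish, except possibly for the entry `(i', i)`, where
`i'` is the successor of `i`. -/
abbrev IsMinParabolic (i i' : Fin n) (g : Matrix (Fin n) (Fin n) K) : Prop :=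
  g.BlockTriangular fun j => if j = i' then i else j

theorem isMinParabolic_of_isUpperTriangular {i i' : Fin n} (hi : i ⋖ i')
    {g : Matrix (Fin n) (Fin n) K} (hg : g.IsUpperTriangular) : IsMinParabolic i i' g := by
  intro a b hab
  apply hg
  have hlt := hi.lt
  have hadj : ∀ a, a < i' → a ≤ i := fun a ha => not_lt.1 fun h => hi.2 h ha
  change b < a
  dsimp only at hab
  split_ifs at hab with h1 h2 h2
  · exact absurd hab (lt_irrefl _)
  · rw [h1]
    exact lt_of_le_of_ne (not_lt.1 fun h => (hadj a h).not_gt hab) (Ne.symm h2)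
  · rw [h2]
    exact hab.trans hlt
  · exact hab

theorem IsMinParabolic.isUpperTriangular {i i' : Fin n} (hi : i ⋖ i')
    {g : Matrix (Fin n) (Fin n) K} (hg : IsMinParabolic i i' g) (h0 : g i' i = 0) :
    g.IsUpperTriangular := by
  intro a b hab
  change b < a at hab
  have hlt := hi.lt
  have hadj : ∀ a, a < i' → a ≤ i := fun a ha => not_lt.1 fun h => hi.2 h ha
  by_cases h1 : a = i'
  · subst h1
    by_cases h2 : b = i
    · rw [h2, h0]
    · apply hg
      simp only [if_pos, if_neg hab.ne]
      exact lt_of_le_of_ne (hadj b hab) h2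
  · apply hg
    simp only [if_neg h1]
    split_ifs with h2
    · exact hlt.trans (h2 ▸ hab)
    · exact hab

theorem isUnit_transvection {i j : Fin n} (hij : i ≠ j) (c : K) :
    IsUnit (Matrix.transvection i j c) := by
  rw [Matrix.isUnit_iff_isUnit_det, Matrix.det_transvection_of_ne i j hij]
  exact isUnit_one

theorem isUpperTriangular_transvection {p q : Fin n} (hpq : p < q) (c : K) :
    (Matrix.transvection p q c).IsUpperTriangular :=
  Matrix.blockTriangular_transvection (b := id) hpq.le c

/-- The big cell of a minimal parabolic subgroup. -/
theorem IsMinParabolic.exists_eq_transvection_mul {i i' : Fin n} (hi : i ⋖ i')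
    {g : Matrix (Fin n) (Fin n) K} (hg : IsMinParabolic i i' g) (hu : IsUnit g) (h0 : g i i ≠ 0) :
    ∃ b : Matrix (Fin n) (Fin n) K, b.IsUpperTriangular ∧ IsUnit b ∧
      g = Matrix.transvection i' i (g i' i / g i i) * b := by
  set τ := g i' i / g i i with hτ
  have hne := hi.lt.ne
  have hpar : IsMinParabolic i i' (Matrix.transvection i' i (-τ)) :=
    Matrix.blockTriangular_transvection (by simp [hne]) _
  refine ⟨Matrix.transvection i' i (-τ) * g, ?_,
    (isUnit_transvection hne.symm _).mul hu, ?_⟩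
  · refine IsMinParabolic.isUpperTriangular hi (hpar.mul hg) ?_
    rw [Matrix.transvection_mul_apply_same, hτ]
    field_simp
    ring
  · rw [← mul_assoc, Matrix.transvection_mul_transvection_same _ _ hne.symm, add_neg_cancel,
      Matrix.transvection_zero, one_mul]

/-- The matrices in a minimal parabolic subgroup to which the orbit computations apply. -/
def genericParabolic (i i' : Fin n) (K : Type*) [Field K] : Set (Matrix (Fin n) (Fin n) K) :=
  {g | IsMinParabolic i i' g ∧ IsUnit g ∧ g i i ≠ 0 ∧ g i i ^ 2 + g i' i ^ 2 ≠ 0}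

/-- The line `g + t E_ii` stays in the parabolic pattern and meets the generic conditions for all
but finitely many `t`. A polynomial vanishing on the generic part therefore vanishes on the whole
line, in particular at `t = 0`. -/
theorem IsMinParabolic.mem_zariskiClosure [Infinite K] {i i' : Fin n} (hi : i ⋖ i')
    {g : Matrix (Fin n) (Fin n) K} (hg : IsMinParabolic i i' g) (hu : IsUnit g) :
    g ∈ zariskiClosure (genericParabolic i i' K) := by
  rw [mem_zariskiClosure_iff]
  intro p hp
  let G : Matrix (Fin n) (Fin n) (Polynomial K) :=
    g.map Polynomial.C + Matrix.single i i Polynomial.X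
  have hG : ∀ t : K, G.map (Polynomial.eval t) = g + Matrix.single i i t := by
    intro t
    ext a b
    simp only [G, Matrix.map_apply, Matrix.add_apply, Polynomial.eval_add, Polynomial.eval_C,
      Matrix.single_apply]
    split_ifs <;> simp
  let f : Polynomial K := MvPolynomial.aeval (fun r : Fin n × Fin n => G r.1 r.2) p
  have hf : ∀ t : K, f.eval t =
      MvPolynomial.eval (fun r : Fin n × Fin n => (g + Matrix.single i i t) r.1 r.2) p := by
    intro t
    rw [← hG t]
    simp only [f]
    rw [← Polynomial.coe_evalRingHom, MvPolynomial.aeval_def, MvPolynomial.hom_eval₂]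
    simp only [MvPolynomial.eval, MvPolynomial.coe_eval₂Hom]
    congr 1
    ext a
    simp
  let a : Polynomial K := Polynomial.C (g i i) + Polynomial.X
  -- The factors of `q` encode invertibility and the two nonvanishing conditions along the line.
  -- Then `f * q` has only zero values, and `q ≠ 0`.
  let q : Polynomial K := G.det * a * (a ^ 2 + Polynomial.C (g i' i) ^ 2)
  have hdet : ∀ t : K, G.det.eval t = (g + Matrix.single i i t).det := by
    intro t
    rw [← hG t, ← Polynomial.coe_evalRingHom, RingHom.map_det]
    rfl
  have hmonic : a.Monic := by
    simp only [a, add_comm (Polynomial.C (g i i))]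
    exact Polynomial.monic_X_add_C _
  have hdeg : a.natDegree = 1 := by
    simp only [a, add_comm (Polynomial.C (g i i))]
    exact Polynomial.natDegree_X_add_C _
  have hq : q ≠ 0 := by
    refine mul_ne_zero (mul_ne_zero ?_ hmonic.ne_zero) ?_
    · intro h
      have := hdet 0
      rw [h] at this
      simp only [Polynomial.eval_zero, Matrix.single_zero, add_zero] at this
      exact ((Matrix.isUnit_iff_isUnit_det g).1 hu).ne_zero this.symm
    · rw [← Polynomial.C_pow]
      refine ((hmonic.pow 2).add_of_left ?_).ne_zero
      refine Polynomial.degree_C_le.trans_lt ?_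
      rw [Polynomial.degree_eq_natDegree (hmonic.pow 2).ne_zero, hmonic.natDegree_pow, hdeg]
      exact_mod_cast (by norm_num : (0 : ℕ) < 2 * 1)
  have hzero : f * q = 0 := by
    apply Polynomial.funext
    intro t
    rw [Polynomial.eval_mul, Polynomial.eval_zero]
    by_cases hqt : q.eval t = 0
    · rw [hqt, mul_zero]
    · simp only [q, a, Polynomial.eval_mul, Polynomial.eval_add, Polynomial.eval_pow,
        Polynomial.eval_C, Polynomial.eval_X, hdet, mul_eq_zero, not_or] at hqt
      rw [hf, hp, zero_mul]
      have e1 : (g + Matrix.single i i t) i i = g i i + t := by simp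
      have e2 : (g + Matrix.single i i t) i' i = g i' i := by simp [hi.lt.ne]
      refine ⟨hg.add (Matrix.blockTriangular_single (by simp) t), ?_, ?_, ?_⟩
      · rw [Matrix.isUnit_iff_isUnit_det]
        exact isUnit_iff_ne_zero.2 hqt.1.1
      · rw [e1]
        exact hqt.1.2
      · rw [e1, e2]
        exact hqt.2
  have hf0 := (mul_eq_zero.1 hzero).resolve_right hq
  have := hf 0
  rw [hf0] at this
  simpa using this.symm

end Parabolic

/-! ### Orbits under lower and upper triangular matrices -/

section Orbits

variable {n : ℕ} {K : Type*} [Field K]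

/-- The orbit of `x` under multiplication by invertible lower triangular matrices on the left and
invertible upper triangular matrices on the right. -/
def lowerUpperOrbit (x : Matrix (Fin n) (Fin n) K) : Set (Matrix (Fin n) (Fin n) K) :=
  {X | ∃ b c : Matrix (Fin n) (Fin n) K, (b.IsUpperTriangular ∧ IsUnit b) ∧
    (c.IsUpperTriangular ∧ IsUnit c) ∧ X = b.transpose * x * c}

theorem self_mem_lowerUpperOrbit (x : Matrix (Fin n) (Fin n) K) : x ∈ lowerUpperOrbit x :=
  ⟨1, 1, ⟨Matrix.blockTriangular_one, isUnit_one⟩, ⟨Matrix.blockTriangular_one, isUnit_one⟩,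
    by simp⟩

theorem mul_mem_lowerUpperOrbit {x X b c : Matrix (Fin n) (Fin n) K}
    (hX : X ∈ lowerUpperOrbit x) (hb : b.IsUpperTriangular ∧ IsUnit b)
    (hc : c.IsUpperTriangular ∧ IsUnit c) : b.transpose * X * c ∈ lowerUpperOrbit x := by
  obtain ⟨b', c', hb', hc', rfl⟩ := hX
  refine ⟨b' * b, c' * c, ⟨hb'.1.mul hb.1, hb'.2.mul hb.2⟩, ⟨hc'.1.mul hc.1, hc'.2.mul hc.2⟩, ?_⟩
  simp only [Matrix.transpose_mul, mul_assoc]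

theorem transpose_mem_lowerUpperOrbit {x X : Matrix (Fin n) (Fin n) K}
    (hX : X ∈ lowerUpperOrbit x) : X.transpose ∈ lowerUpperOrbit x.transpose := by
  obtain ⟨b, c, hb, hc, rfl⟩ := hX
  refine ⟨c, b, hc, hb, ?_⟩
  simp only [Matrix.transpose_mul, Matrix.transpose_transpose, mul_assoc]

theorem zariskiClosure_lowerUpperOrbit_trans {x y z : Matrix (Fin n) (Fin n) K}
    (hy : y ∈ zariskiClosure (lowerUpperOrbit x)) (hz : z ∈ zariskiClosure (lowerUpperOrbit y)) :
    z ∈ zariskiClosure (lowerUpperOrbit x) := by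
  refine zariskiClosure_subset ?_ hz
  rintro _ ⟨b, c, hb, hc, rfl⟩
  exact mul_mul_mem_zariskiClosure b.transpose c
    (fun Y hY => subset_zariskiClosure _ (mul_mem_lowerUpperOrbit hY hb hc)) hy

/-- The one in column `i'` is below a one in column `i`. -/
theorem RowLE.exists_lt {x : Matrix (Fin n) (Fin n) K} (hx : IsRook x) {i i' : Fin n}
    (hi : i ≠ i') (h : RowLE x.transpose i i') {q : Fin n} (hq : x q i' = 1) :
    ∃ p < q, x p i = 1 := by
  have h1 : 1 ≤ blockCount x.transpose {i'} (Finset.Iic q) :=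
    blockCount_singleton_pos.2 ⟨q, by simp, hq⟩
  have h2 := h (Finset.Iic q) (by rw [Finset.coe_Iic]; exact isLowerSet_Iic q)
  obtain ⟨p, hp, hp'⟩ := blockCount_singleton_pos.1 (h1.trans h2)
  refine ⟨p, lt_of_le_of_ne (Finset.mem_Iic.1 hp) ?_, hp'⟩
  rintro rfl
  exact hi (hx.2.1 _ _ _ hp' hq)

theorem IsRook.mul_single {x : Matrix (Fin n) (Fin n) K} (hx : IsRook x) {q j : Fin n}
    (h : x q j = 1) (i : Fin n) (τ : K) : x * Matrix.single j i τ = Matrix.single q i τ := by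
  ext a b
  rcases eq_or_ne b i with rfl | hb
  · rw [Matrix.mul_single_apply_same]
    rcases eq_or_ne a q with rfl | ha
    · simp [h]
    · have : x a j = 0 := (hx.1 a j).resolve_right fun e => ha (hx.2.2 _ _ _ e h)
      simp [this, ha.symm]
  · rw [Matrix.mul_single_apply_of_ne _ _ _ _ _ hb, Matrix.single_apply_of_col_ne]
    exact hb.symm

theorem IsRook.single_mul {x : Matrix (Fin n) (Fin n) K} (hx : IsRook x) {q j : Fin n}
    (h : x q j = 1) (i : Fin n) (τ : K) : Matrix.single i q τ * x = Matrix.single i j τ := by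
  have := congrArg Matrix.transpose (hx.transpose.mul_single (q := j) (j := q) h i τ)
  simpa [Matrix.transpose_mul] using this

/-- Lower triangular column operations on adjacent columns in increasing position can be replaced
by lower triangular row operations. -/
theorem IsRook.mul_transvection {x : Matrix (Fin n) (Fin n) K} (hx : IsRook x) {i i' : Fin n}
    (hi : i ⋖ i') (h : RowLE x.transpose i i') (τ : K) :
    ∃ d : Matrix (Fin n) (Fin n) K, (d.IsUpperTriangular ∧ IsUnit d) ∧
      x * Matrix.transvection i' i τ = d.transpose * x ∧
      (1 + τ ^ 2 ≠ 0 → (d * Matrix.transvection i' i τ) i i ≠ 0) := by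
  have hne := hi.lt.ne
  by_cases hcol : ∃ q, x q i' = 1
  · obtain ⟨q, hq⟩ := hcol
    -- With ones at `(p, i)` and `(q, i')`, one has `x E_{i'i} = E_{qi} = E_{qp} x`, and `p < q`
    -- makes `d = 1 + τ E_{pq}` upper triangular. The entry in question is `1 + τ ^ 2` if `(p, q) =
    -- (i, i')`, and `1` in all other cases.
    obtain ⟨p, hpq, hp⟩ := h.exists_lt hx hne hq
    refine ⟨Matrix.transvection p q τ,
      ⟨isUpperTriangular_transvection hpq τ, isUnit_transvection hpq.ne τ⟩, ?_, fun hτ => ?_⟩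
    · simp only [Matrix.transvection, Matrix.transpose_add, Matrix.transpose_one,
        Matrix.transpose_single, mul_add, add_mul, mul_one, one_mul, hx.mul_single hq,
        hx.single_mul hp]
    · rcases eq_or_ne i p with rfl | h1
      · rw [Matrix.transvection_mul_apply_same]
        rcases eq_or_ne q i' with rfl | h2
        · simp only [Matrix.transvection, Matrix.add_apply, Matrix.one_apply_eq,
            Matrix.one_apply_ne hne.symm, Matrix.single_apply_same, zero_add]
          rw [Matrix.single_apply_of_row_ne hne.symm]
          simpa [sq] using hτ
        · simp [Matrix.transvection, hne.symm, hpq.ne', h2.symm]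
      · rw [Matrix.transvection_mul_apply_of_ne _ _ _ _ h1]
        simp [Matrix.transvection, hne.symm]
  · refine ⟨1, ⟨Matrix.blockTriangular_one, isUnit_one⟩, ?_, fun _ => ?_⟩
    · have : x * Matrix.single i' i τ = 0 := by
        ext a b
        rcases eq_or_ne b i with rfl | hb
        · rw [Matrix.mul_single_apply_same,
            (hx.1 a i').resolve_right fun e => hcol ⟨a, e⟩]
          simp
        · rw [Matrix.mul_single_apply_of_ne _ _ _ _ _ hb]
          simp
      simp [Matrix.transvection, mul_add, this]
    · simp [Matrix.transvection, hne.symm]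

theorem IsRook.mul_mem_lowerUpperOrbit {x : Matrix (Fin n) (Fin n) K} (hx : IsRook x)
    {i i' : Fin n} (hi : i ⋖ i') (h : RowLE x.transpose i i') {g : Matrix (Fin n) (Fin n) K}
    (hg : IsMinParabolic i i' g) (hu : IsUnit g) (h0 : g i i ≠ 0) :
    x * g ∈ lowerUpperOrbit x := by
  obtain ⟨b, hb, hub, e⟩ := hg.exists_eq_transvection_mul hi hu h0
  obtain ⟨d, hd, e', -⟩ := hx.mul_transvection hi h (g i' i / g i i)
  refine ⟨d, b, hd, ⟨hb, hub⟩, ?_⟩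
  rw [e, ← mul_assoc, e']

/-- The matrix of a transposition. -/
abbrev swapMatrix (K : Type*) [Field K] (i i' : Fin n) : Matrix (Fin n) (Fin n) K :=
  swapCol 1 i i'

theorem mul_swapMatrix (X : Matrix (Fin n) (Fin n) K) (i i' : Fin n) :
    X * swapMatrix K i i' = swapCol X i i' := by
  ext a b
  simp [Matrix.mul_apply, Matrix.one_apply]

theorem swapMatrix_mul_self (i i' : Fin n) : swapMatrix K i i' * swapMatrix K i i' = 1 := by
  rw [mul_swapMatrix]
  ext a b
  exact congrArg (fun c => (1 : Matrix (Fin n) (Fin n) K) a c) (Equiv.swap_apply_self i i' b)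

theorem isUnit_swapMatrix (i i' : Fin n) : IsUnit (swapMatrix K i i') :=
  IsUnit.of_mul_eq_one _ (swapMatrix_mul_self i i')

theorem transpose_swapMatrix (i i' : Fin n) :
    (swapMatrix K i i').transpose = swapMatrix K i i' := by
  ext a b
  simp only [swapMatrix, Matrix.transpose_apply, Matrix.submatrix_apply, id, Matrix.one_apply]
  congr 1
  rw [eq_iff_iff, eq_comm, ← Equiv.eq_symm_apply, Equiv.symm_swap]

theorem swapMatrix_mul (X : Matrix (Fin n) (Fin n) K) (i i' : Fin n) :
    swapMatrix K i i' * X = swapRow X i i' := by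
  have := congrArg Matrix.transpose (mul_swapMatrix X.transpose i i')
  rwa [Matrix.transpose_mul, Matrix.transpose_transpose, transpose_swapMatrix] at this

theorem isMinParabolic_swapMatrix {i i' : Fin n} :
    IsMinParabolic i i' (swapMatrix K i i') := by
  intro a b hab
  refine Matrix.one_apply_ne ?_
  rintro rfl
  refine hab.ne ?_
  change (if b = i' then i else b) =
    if Equiv.swap i i' b = i' then i else Equiv.swap i i' b
  rcases eq_or_ne b i with rfl | h1
  · simp
  rcases eq_or_ne b i' with rfl | h2
  · simp
  rw [Equiv.swap_apply_of_ne_of_ne h1 h2]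

/-- The transposition lies in the minimal parabolic of `(i, i')`. Generic parabolic elements keep
`x` in its orbit, and density of the generic part extends this to `c * swapMatrix K i i'` at the
level of closures. -/
theorem IsRook.swapCol_mem_zariskiClosure [Infinite K] {x : Matrix (Fin n) (Fin n) K}
    (hx : IsRook x) {i i' : Fin n} (hi : i ⋖ i') (h : RowLE x.transpose i i')
    {X : Matrix (Fin n) (Fin n) K} (hX : X ∈ zariskiClosure (lowerUpperOrbit x)) :
    swapCol X i i' ∈ zariskiClosure (lowerUpperOrbit x) := by
  rw [← mul_swapMatrix, ← one_mul X]
  refine mul_mul_mem_zariskiClosure 1 (swapMatrix K i i') ?_ hX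
  rintro _ ⟨b, c, hb, hc, rfl⟩
  have hg : IsMinParabolic i i' (c * swapMatrix K i i') :=
    (isMinParabolic_of_isUpperTriangular hi hc.1).mul isMinParabolic_swapMatrix
  have := mul_mul_mem_zariskiClosure (T := lowerUpperOrbit x) (b.transpose * x) 1
    (fun g hg => ?_) (hg.mem_zariskiClosure hi (hc.2.mul (isUnit_swapMatrix i i')))
  · simpa only [mul_one, one_mul, mul_assoc] using this
  · rw [mul_assoc b.transpose]
    exact subset_zariskiClosure _ (_root_.mul_mem_lowerUpperOrbit
      (hx.mul_mem_lowerUpperOrbit hi h hg.1 hg.2.1 hg.2.2.1) hb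
      ⟨Matrix.blockTriangular_one, isUnit_one⟩)

theorem IsRook.swapRow_mem_zariskiClosure [Infinite K] {x : Matrix (Fin n) (Fin n) K}
    (hx : IsRook x) {i i' : Fin n} (hi : i ⋖ i') (h : RowLE x i i')
    {X : Matrix (Fin n) (Fin n) K} (hX : X ∈ zariskiClosure (lowerUpperOrbit x)) :
    swapRow X i i' ∈ zariskiClosure (lowerUpperOrbit x) := by
  have h1 : X.transpose ∈ zariskiClosure (lowerUpperOrbit x.transpose) :=
    transpose_mem_zariskiClosure
      (fun Y hY => subset_zariskiClosure _ (transpose_mem_lowerUpperOrbit hY)) hX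
  have h2 := hx.transpose.swapCol_mem_zariskiClosure hi h h1
  exact transpose_mem_zariskiClosure
    (fun Y hY => subset_zariskiClosure _ (transpose_mem_lowerUpperOrbit hY)) h2

end Orbits

/-! ### Square roots of invertible matrices and congruence orbits -/

section Congruence

variable {n : ℕ} {K : Type*} [Field K]

open Polynomial in
/-- Over an algebraically closed field of characteristic zero an invertible matrix has a square root
which is a polynomial in it. -/
theorem exists_mem_adjoin_mul_self_eq [IsAlgClosed K] [CharZero K]
    {V : Matrix (Fin n) (Fin n) K} (hV : IsUnit V) :
    ∃ W ∈ Algebra.adjoin K {V}, W * W = V := by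
  classical
  set v : Algebra.adjoin K {V} := ⟨V, Algebra.self_mem_adjoin_singleton K V⟩ with hv
  choose r hr using fun a : K => IsAlgClosed.exists_pow_nat_eq a (n := 2) two_pos
  -- `q` takes a square root of each eigenvalue as its value there, so `q(V) ^ 2 - V` is nilpotent.
  -- Newton iteration then corrects `q(V)` to an exact square root.
  set q : K[X] := Lagrange.interpolate V.charpoly.roots.toFinset id r with hq
  have hroot : ∀ a ∈ V.charpoly.roots, (X - C a) ∣ q ^ 2 - X := by
    intro a ha
    rw [dvd_iff_isRoot, IsRoot, eval_sub, eval_pow, eval_X, hq]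
    have := Lagrange.eval_interpolate_at_node (s := V.charpoly.roots.toFinset) (v := id) r
      Function.injective_id.injOn (Multiset.mem_toFinset.2 ha)
    rw [id] at this
    rw [this, hr, sub_self]
  have hdvd : V.charpoly ∣ (q ^ 2 - X) ^ V.charpoly.roots.card := by
    have h1 := (IsAlgClosed.splits V.charpoly).eq_prod_roots_of_monic V.charpoly_monic
    have h2 := Multiset.prod_dvd_prod_of_dvd (S := V.charpoly.roots) (fun a => X - C a)
      (fun _ => q ^ 2 - X) hroot
    rw [← h1, Multiset.map_const', Multiset.prod_replicate] at h2
    exact h2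
  have hnil : IsNilpotent (aeval v (q ^ 2 - X)) := by
    refine ⟨V.charpoly.roots.card, ?_⟩
    obtain ⟨f, hf⟩ := hdvd
    rw [← map_pow, Subtype.ext_iff, coe_aeval_mk_apply, hf, map_mul, Matrix.aeval_self_charpoly,
      zero_mul]
    rfl
  -- Invertibility must hold inside the subalgebra generated by `V`. It is finite-dimensional, hence
  -- Artinian, so a nonzerodivisor is a unit.
  have hunit : IsUnit v := by
    have : IsArtinianRing (Algebra.adjoin K {V}) := IsArtinianRing.of_finite K _
    refine IsArtinianRing.isUnit_of_mem_nonZeroDivisors ?_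
    rw [mem_nonZeroDivisors_iff_right]
    intro z hz
    have hz' : z.1 * V = 0 := congrArg Subtype.val hz
    exact Subtype.ext (hV.mul_left_eq_zero.1 hz')
  set w := aeval v q with hw
  have hw2 : w ^ 2 = v + aeval v (q ^ 2 - X) := by
    rw [map_sub, map_pow, aeval_X]
    ring
  have hwu : IsUnit w := by
    have : IsUnit (w ^ 2) := by
      rw [hw2]
      exact (IsNilpotent.isUnit_add_left_of_commute hnil hunit (Commute.all _ _))
    exact (isUnit_pow_iff two_ne_zero).1 this
  have h2 : IsUnit (2 : Algebra.adjoin K {V}) := by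
    have := (isUnit_iff_ne_zero.2 (two_ne_zero (α := K))).map (algebraMap K (Algebra.adjoin K {V}))
    rwa [map_ofNat] at this
  let P : (Algebra.adjoin K {V})[X] := X ^ 2 - C v
  -- Newton's lemma for `X ^ 2 - v` at `w`: the value is nilpotent and the derivative `2 * w` is a
  -- unit, the latter using characteristic zero.
  obtain ⟨s, ⟨-, hs⟩, -⟩ := existsUnique_nilpotent_sub_and_aeval_eq_zero (P := P) (x := w)
    (by
      simp only [P, map_sub, map_pow, aeval_X, aeval_C, hw2]
      simpa using hnil)
    (by
      simp only [P, derivative_sub, derivative_X_pow, derivative_C]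
      simpa using h2.mul hwu)
  refine ⟨s.1, s.2, ?_⟩
  simp only [P, map_sub, map_pow, aeval_X, aeval_C, sub_eq_zero] at hs
  have := congrArg Subtype.val hs
  simpa [sq] using this

theorem mem_congruenceOrbit_iff {x X : Matrix (Fin n) (Fin n) K} :
    X ∈ congruenceOrbit x ↔ ∃ d : Matrix (Fin n) (Fin n) K,
      (d.IsUpperTriangular ∧ IsUnit d) ∧ X = d.transpose * x * d := by
  constructor
  · rintro ⟨b, hb, rfl⟩
    exact ⟨_, ⟨isUpperTriangular_inv hb, (b⁻¹).isUnit⟩, rfl⟩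
  · rintro ⟨d, ⟨hd, u, rfl⟩, rfl⟩
    exact ⟨u⁻¹, isUpperTriangular_inv hd, by rw [inv_inv]⟩

theorem mul_mem_congruenceOrbit {x X d : Matrix (Fin n) (Fin n) K}
    (hX : X ∈ congruenceOrbit x) (hd : d.IsUpperTriangular ∧ IsUnit d) :
    d.transpose * X * d ∈ congruenceOrbit x := by
  obtain ⟨d', hd', rfl⟩ := mem_congruenceOrbit_iff.1 hX
  refine mem_congruenceOrbit_iff.2 ⟨d' * d, ⟨hd'.1.mul hd.1, hd'.2.mul hd.2⟩, ?_⟩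
  simp only [Matrix.transpose_mul, mul_assoc]

theorem congruenceOrbit_subset_zariskiClosure {x y : Matrix (Fin n) (Fin n) K}
    (hy : y ∈ zariskiClosure (congruenceOrbit x)) :
    congruenceOrbit y ⊆ zariskiClosure (congruenceOrbit x) := by
  intro X hX
  obtain ⟨d, hd, rfl⟩ := mem_congruenceOrbit_iff.1 hX
  exact mul_mul_mem_zariskiClosure d.transpose d
    (fun Y hY => subset_zariskiClosure _ (mul_mem_congruenceOrbit hY hd)) hy

theorem zariskiClosure_congruenceOrbit_trans {x y z : Matrix (Fin n) (Fin n) K}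
    (hy : y ∈ zariskiClosure (congruenceOrbit x)) (hz : z ∈ zariskiClosure (congruenceOrbit y)) :
    z ∈ zariskiClosure (congruenceOrbit x) :=
  zariskiClosure_subset (congruenceOrbit_subset_zariskiClosure hy) hz

/-- Symmetric matrices in the same two-sided triangular orbit are congruent by a triangular
matrix. -/
theorem mem_congruenceOrbit_of_mem_lowerUpperOrbit [IsAlgClosed K] [CharZero K]
    {x X : Matrix (Fin n) (Fin n) K} (hx : x.IsSymm) (hX : X.IsSymm)
    (h : X ∈ lowerUpperOrbit x) : X ∈ congruenceOrbit x := by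
  obtain ⟨b, c, hb, ⟨hc, u, rfl⟩, rfl⟩ := h
  set V : Matrix (Fin n) (Fin n) K := b * (u⁻¹).1 with hV
  have hbV : b = V * u.1 := by rw [hV, mul_assoc, Units.inv_mul, mul_one]
  have hVu : IsUnit V := hb.2.mul (u⁻¹).isUnit
  have hVt : V.IsUpperTriangular := hb.1.mul (isUpperTriangular_inv hc)
  -- This is the symmetry of `b.transpose * x * u = u.transpose * V.transpose * x * u`, with `u`
  -- cancelled on both sides.
  have hcomm : x * V = V.transpose * x := by
    have h1 := hX.eq
    rw [hbV] at h1
    simp only [Matrix.transpose_mul, Matrix.transpose_transpose, hx.eq] at h1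
    have h2 : u.1.transpose * (x * V) * u.1 = u.1.transpose * (V.transpose * x) * u.1 := by
      simpa only [mul_assoc] using h1
    have h3 := u.isUnit.mul_left_injective h2
    exact ((Matrix.isUnit_transpose _).2 u.isUnit).mul_right_injective h3
  -- Being a polynomial in `V`, the root `W` is upper triangular and also satisfies `x * W =
  -- W.transpose * x`. Moving one factor of `V.transpose = W.transpose * W.transpose` across `x`
  -- yields the congruence by `W * u`.
  obtain ⟨W, hW, hWV⟩ := exists_mem_adjoin_mul_self_eq hVu
  have hWt : W.IsUpperTriangular := by
    have : Algebra.adjoin K {V} ≤ Matrix.blockTriangularSubalgebra K K (id : Fin n → Fin n) :=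
      Algebra.adjoin_le (Set.singleton_subset_iff.2 hVt)
    exact this hW
  have hWc : x * W = W.transpose * x := by
    clear hWV hWt
    induction hW using Algebra.adjoin_induction with
    | mem y hy => rw [Set.mem_singleton_iff.1 hy, hcomm]
    | algebraMap r =>
      rw [← Algebra.commutes, Matrix.algebraMap_eq_diagonal, Matrix.diagonal_transpose]
    | add y z _ _ hy hz => rw [mul_add, hy, hz, Matrix.transpose_add, add_mul]
    | mul y z hy' hz' hy hz =>
      have hyz : y * z = z * y := by
        have := mul_comm (⟨y, hy'⟩ : Algebra.adjoin K {V}) ⟨z, hz'⟩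
        exact congrArg Subtype.val this
      rw [hyz, ← mul_assoc, hz, mul_assoc, hy, ← mul_assoc, ← Matrix.transpose_mul, hyz]
  have hWu : IsUnit W := isUnit_of_mul_isUnit_left (hWV ▸ hVu)
  refine mem_congruenceOrbit_iff.2 ⟨W * u.1, ⟨hWt.mul hc, hWu.mul u.isUnit⟩, ?_⟩
  rw [hbV, ← hWV]
  simp only [Matrix.transpose_mul, mul_assoc]
  rw [← mul_assoc x, hWc, mul_assoc]

/-- Write `g = l * b` with `l` a lower transvection and `x * l = d.transpose * x`. Then `l.transpose
* x * l` is the transpose of `x * (d * l)`, which stays in the two-sided orbit if `(d * l) i i ≠ 0`.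
That is ensured by `1 + τ ^ 2 ≠ 0`, the reason for the sum of squares in `genericParabolic`.
Symmetry upgrades the result to a congruence. -/
theorem IsRook.transpose_mul_mul_mem_congruenceOrbit [IsAlgClosed K] [CharZero K]
    {x : Matrix (Fin n) (Fin n) K} (hx : IsRook x) (hs : x.IsSymm) {i i' : Fin n} (hi : i ⋖ i')
    (h : RowLE x i i') {g : Matrix (Fin n) (Fin n) K} (hg : g ∈ genericParabolic i i' K) :
    g.transpose * x * g ∈ congruenceOrbit x := by
  obtain ⟨hg, hu, h0, h1⟩ := hg
  have h' : RowLE x.transpose i i' := by rwa [hs.eq]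
  obtain ⟨b, hb, hub, e⟩ := hg.exists_eq_transvection_mul hi hu h0
  obtain ⟨d, hd, e', hne⟩ := hx.mul_transvection hi h' (g i' i / g i i)
  set l := Matrix.transvection i' i (g i' i / g i i)
  have hl : l.transpose * x * l ∈ lowerUpperOrbit x := by
    have hl : IsMinParabolic i i' l :=
      Matrix.blockTriangular_transvection (by simp [hi.lt.ne]) _
    have h2 := hx.mul_mem_lowerUpperOrbit hi h'
      ((isMinParabolic_of_isUpperTriangular hi hd.1).mul hl)
      (hd.2.mul (isUnit_transvection hi.lt.ne' _)) (hne ?_)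
    · have h3 := transpose_mem_lowerUpperOrbit h2
      rw [hs.eq, Matrix.transpose_mul, Matrix.transpose_mul, hs.eq, mul_assoc, ← e'] at h3
      rwa [mul_assoc]
    · rw [div_pow]
      field_simp
      exact div_ne_zero h1 (pow_ne_zero 2 h0)
  have hl' := mem_congruenceOrbit_of_mem_lowerUpperOrbit hs
    (by rw [Matrix.IsSymm]; simp only [Matrix.transpose_mul, Matrix.transpose_transpose, hs.eq,
      mul_assoc]) hl
  have := mul_mem_congruenceOrbit hl' ⟨hb, hub⟩
  rw [e]
  simpa only [Matrix.transpose_mul, mul_assoc] using this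

/-- The closure of a congruence orbit is stable under the minimal parabolic subgroups of its
ascents. -/
theorem IsRook.transpose_mul_mul_mem_zariskiClosure [IsAlgClosed K] [CharZero K]
    {x : Matrix (Fin n) (Fin n) K} (hx : IsRook x) (hs : x.IsSymm) {i i' : Fin n} (hi : i ⋖ i')
    (h : RowLE x i i') {g : Matrix (Fin n) (Fin n) K} (hg : IsMinParabolic i i' g)
    (hu : IsUnit g) {X : Matrix (Fin n) (Fin n) K}
    (hX : X ∈ zariskiClosure (congruenceOrbit x)) :
    g.transpose * X * g ∈ zariskiClosure (congruenceOrbit x) := by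
  have : Infinite K := IsAlgClosed.instInfinite
  refine mul_mul_mem_zariskiClosure g.transpose g (fun Y hY => ?_) hX
  obtain ⟨d, hd, rfl⟩ := mem_congruenceOrbit_iff.1 hY
  have hdg : IsMinParabolic i i' (d * g) :=
    (isMinParabolic_of_isUpperTriangular hi hd.1).mul hg
  have := _root_.transpose_mul_mul_mem_zariskiClosure (T := congruenceOrbit x) x
    (fun g' hg' => subset_zariskiClosure _
      (hx.transpose_mul_mul_mem_congruenceOrbit hs hi h hg'))
    (hdg.mem_zariskiClosure hi (hd.2.mul hu))
  simpa only [Matrix.transpose_mul, mul_assoc] using this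

theorem IsRook.swapBoth_mem_zariskiClosure [IsAlgClosed K] [CharZero K]
    {x : Matrix (Fin n) (Fin n) K} (hx : IsRook x) (hs : x.IsSymm) {i i' : Fin n} (hi : i ⋖ i')
    (h : RowLE x i i') {X : Matrix (Fin n) (Fin n) K}
    (hX : X ∈ zariskiClosure (congruenceOrbit x)) :
    swapBoth X i i' ∈ zariskiClosure (congruenceOrbit x) := by
  have := hx.transpose_mul_mul_mem_zariskiClosure hs hi h isMinParabolic_swapMatrix
    (isUnit_swapMatrix i i') hX
  rwa [transpose_swapMatrix, swapMatrix_mul, mul_swapMatrix] at this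

/-- The transposition `s` has a symmetric square root `m = ((1 + c) + (1 - c) s) / 2` with `c ^ 2 =
-1`. It lies in the minimal parabolic and commutes with `X`, so congruence by `m` gives `X * m * m =
X * s`. -/
theorem IsRook.swapCol_mem_zariskiClosure_congruenceOrbit [IsAlgClosed K] [CharZero K]
    {x : Matrix (Fin n) (Fin n) K} (hx : IsRook x) (hs : x.IsSymm) {i i' : Fin n} (hi : i ⋖ i')
    (h : RowLE x i i') {X : Matrix (Fin n) (Fin n) K} (hXi : swapBoth X i i' = X)
    (hX : X ∈ zariskiClosure (congruenceOrbit x)) :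
    swapCol X i i' ∈ zariskiClosure (congruenceOrbit x) := by
  obtain ⟨c, hc⟩ := IsAlgClosed.exists_pow_nat_eq (-1 : K) (n := 2) two_pos
  set s := swapMatrix K i i'
  have hss : s * s = 1 := swapMatrix_mul_self i i'
  have hcomm : s * X = X * s := by
    have h1 : s * X * s = X := by rw [swapMatrix_mul, mul_swapMatrix]; exact hXi
    calc s * X = s * X * (s * s) := by rw [hss, mul_one]
      _ = s * X * s * s := by rw [mul_assoc _ s s]
      _ = X * s := by rw [h1]
  set m : Matrix (Fin n) (Fin n) K := ((1 + c) / 2) • (1 : Matrix (Fin n) (Fin n) K) +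
    ((1 - c) / 2) • s with hm
  have hmm : m * m = s := by
    simp only [hm, mul_add, add_mul, smul_mul_assoc, mul_smul_comm, mul_one, one_mul, hss,
      smul_add, smul_smul]
    have e1 : (1 + c) / 2 * ((1 + c) / 2) + (1 - c) / 2 * ((1 - c) / 2) = 0 := by
      field_simp
      linear_combination 2 * hc
    have e2 : (1 + c) / 2 * ((1 - c) / 2) + (1 + c) / 2 * ((1 - c) / 2) = 1 := by
      field_simp
      linear_combination -2 * hc
    calc _ = ((1 + c) / 2 * ((1 + c) / 2) + (1 - c) / 2 * ((1 - c) / 2)) •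
          (1 : Matrix (Fin n) (Fin n) K) +
          ((1 + c) / 2 * ((1 - c) / 2) + (1 + c) / 2 * ((1 - c) / 2)) • s := by
          module
      _ = s := by rw [e1, e2, zero_smul, zero_add, one_smul]
  have hmt : m.transpose = m := by
    simp only [hm, Matrix.transpose_add, Matrix.transpose_smul, Matrix.transpose_one, s,
      transpose_swapMatrix]
  have hmX : m * X = X * m := by
    simp only [hm, add_mul, mul_add, smul_mul_assoc, mul_smul_comm, one_mul, mul_one, hcomm]
  have hmp : IsMinParabolic i i' m :=
    Matrix.BlockTriangular.add
      (fun a b hab => by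
        have h1 : (1 : Matrix (Fin n) (Fin n) K) a b = 0 :=
          Matrix.blockTriangular_one (b := fun j => if j = i' then i else j) hab
        rw [Matrix.smul_apply, h1, smul_zero])
      (fun a b hab => by
        have h1 : s a b = 0 := isMinParabolic_swapMatrix hab
        rw [Matrix.smul_apply, h1, smul_zero])
  have hmu : IsUnit m := by
    refine isUnit_of_mul_isUnit_left (y := m) ?_
    rw [hmm]
    exact isUnit_swapMatrix i i'
  have := hx.transpose_mul_mul_mem_zariskiClosure hs hi h hmp hmu hX
  rwa [hmt, hmX, mul_assoc, hmm, mul_swapMatrix] at this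

end Congruence

/-! ### Comparison of the closure orders with the rank orders -/

section Comparison

variable {n k : ℕ} {K : Type*} [Field K]

/-- Membership in orbit closures is reflexive, transitive and stable under the ascents of `x`, so
the generation principle `IsLiftingSystem.rel_of_le` applies. -/
theorem RankRook.mem_zariskiClosure_of_le [Infinite K] (hk : n ≤ k + 1) {x y : RankRook n k K}
    (h : x ≤ y) : y.1 ∈ zariskiClosure (lowerUpperOrbit x.1) := by
  refine (isLiftingSystem_swap hk).rel_of_le
    (G := fun x y : RankRook n k K => y.1 ∈ zariskiClosure (lowerUpperOrbit x.1))
    (fun x => subset_zariskiClosure _ (self_mem_lowerUpperOrbit x.1))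
    (fun x y z => zariskiClosure_lowerUpperOrbit_trans) ?_ h
  rintro (p | p) x z hx hz
  · exact x.2.1.swapRow_mem_zariskiClosure p.2 (rowLE_of_le_swap_inl hk hx) hz
  · exact x.2.1.swapCol_mem_zariskiClosure p.2 (rowLE_of_le_swap_inr hk hx) hz

theorem SymmRankRook.mem_zariskiClosure_of_le [IsAlgClosed K] [CharZero K] (hk : n ≤ k + 1)
    {x y : SymmRankRook n k K} (h : x ≤ y) :
    y.1.1 ∈ zariskiClosure (congruenceOrbit x.1.1) := by
  refine (isLiftingSystem_swap hk).rel_of_le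
    (G := fun x y : SymmRankRook n k K => y.1.1 ∈ zariskiClosure (congruenceOrbit x.1.1))
    (fun x => subset_zariskiClosure _ (self_mem_congruenceOrbit x.1.1))
    (fun x y z => zariskiClosure_congruenceOrbit_trans) ?_ h
  intro p x z hx hz
  have hx' := rowLE_of_le_swap hk hx
  by_cases hs : swapBoth z.1.1 p.1.1 p.1.2 = z.1.1
  · rw [coe_swap_of_eq hs]
    exact x.1.2.1.swapCol_mem_zariskiClosure_congruenceOrbit x.2 p.2 hx' hs hz
  · rw [coe_swap_of_ne hs]
    exact x.1.2.1.swapBoth_mem_zariskiClosure x.2 p.2 hx' hz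

/-- Reversal of the rows. -/
abbrev revRow (x : Matrix (Fin n) (Fin n) K) : Matrix (Fin n) (Fin n) K :=
  x.submatrix Fin.revPerm (Equiv.refl _)

omit [Field K] in
theorem revRow_revRow (x : Matrix (Fin n) (Fin n) K) : revRow (revRow x) = x := by
  ext i j
  simp

/-- Conjugation by the reversal permutation exchanges upper and lower triangular matrices, so row
reversal maps lower-upper orbits to Borel double orbits. This, like the necessity of the rank
conditions, holds for every `k`. -/
theorem borelOrbit_subset_of_mem {x y : Matrix (Fin n) (Fin n) K}
    (h : revRow x ∈ zariskiClosure (lowerUpperOrbit (revRow y))) :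
    borelOrbit x ⊆ zariskiClosure (borelOrbit y) := by
  have hx : x ∈ zariskiClosure (borelOrbit y) := by
    rw [← revRow_revRow x]
    refine map_mem_zariskiClosure (F := revRow)
      ((Matrix.mvPolynomialX (Fin n) (Fin n) K).submatrix Fin.revPerm (Equiv.refl _))
      (fun Y => ?_) (fun Y hY => subset_zariskiClosure _ ?_) h
    · rw [← Matrix.submatrix_map, mvPolynomialX_map_eval]
    · obtain ⟨b, c, ⟨hb, hbu⟩, ⟨hc, u, rfl⟩, rfl⟩ := hY
      have hb' : IsUnit (b.transpose.submatrix (Fin.revPerm (n := n)) Fin.revPerm) :=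
        (Matrix.isUnit_submatrix_equiv _ _).2 ((Matrix.isUnit_transpose _).2 hbu)
      obtain ⟨v, hv⟩ := hb'
      refine ⟨v, u⁻¹, ?_, isUpperTriangular_inv hc, ?_⟩
      · intro i j hij
        rw [hv]
        exact hb (Fin.rev_lt_rev.2 hij)
      · rw [hv, inv_inv, revRow, ← Matrix.submatrix_mul_equiv _ _ _ (Equiv.refl _),
          ← Matrix.submatrix_mul_equiv _ _ _ Fin.revPerm, Matrix.submatrix_submatrix]
        congr 1
        congr 1
        ext i j
        simp
  rintro _ ⟨b, c, hb, hc, rfl⟩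
  refine mul_mul_mem_zariskiClosure b.1 (c⁻¹).1 (fun Y hY => subset_zariskiClosure _ ?_) hx
  obtain ⟨b', c', hb', hc', rfl⟩ := hY
  refine ⟨b * b', c * c', hb.mul hb', hc.mul hc', ?_⟩
  simp only [Units.val_mul, mul_inv_rev, mul_assoc]

theorem rankLE_revRow_of_borelOrbit_subset {x y : Matrix (Fin n) (Fin n) K} (hx : IsRook x)
    (hy : IsRook y) (h : borelOrbit x ⊆ zariskiClosure (borelOrbit y)) :
    RankLE (revRow y) (revRow x) := by
  intro I J hI hJ
  rw [blockCount_submatrix, blockCount_submatrix]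
  refine borelOrbit_blockCount_le hx hy h _ _ ?_ ?_
  · intro i hi i' hi'
    rw [Finset.mem_map_equiv] at hi hi'
    refine not_le.1 fun hle => hi' (hI ?_ hi)
    simpa using hle
  · intro j hj j' hj'
    rw [Finset.mem_map_equiv] at hj hj'
    exact not_le.1 fun hle => hj' (hJ hle hj)

theorem rankLE_of_congruenceOrbit_subset {x y : Matrix (Fin n) (Fin n) K} (hx : IsRook x)
    (hy : IsRook y) (h : congruenceOrbit x ⊆ zariskiClosure (congruenceOrbit y)) :
    RankLE y x := by
  intro I J hI hJ
  exact congruenceOrbit_blockCount_le hx hy h _ _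
    (fun i hi i' hi' => not_le.1 fun hle => hi' (hI hle hi))
    fun j hj j' hj' => not_le.1 fun hle => hj' (hJ hle hj)

/-- Rook matrices with `k` ones, with the rows reversed. -/
def rookStratumEquiv (n k : ℕ) (K : Type*) [Field K] : rookStratum n k K ≃ RankRook n k K where
  toFun x := ⟨revRow x.1.1, x.1.2.submatrix _ _, (x.1.2.numNonzero_submatrix _ _).trans x.2⟩
  invFun x := ⟨⟨revRow x.1, x.2.1.submatrix _ _⟩, (x.2.1.numNonzero_submatrix _ _).trans x.2.2⟩
  left_inv x := Subtype.ext (Subtype.ext (revRow_revRow x.1.1))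
  right_inv x := Subtype.ext (revRow_revRow x.1)

/-- Partial involutions with `k` nonzero entries as symmetric rook matrices. -/
def partialInvolutionStratumEquiv (n k : ℕ) (K : Type*) [Field K] :
    partialInvolutionStratum n k K ≃ SymmRankRook n k K where
  toFun x := ⟨⟨x.1.1, x.1.2.1, x.2⟩, x.1.2.2⟩
  invFun x := ⟨⟨x.1.1, x.1.2.1, x.2⟩, x.1.2.2⟩
  left_inv _ := rfl
  right_inv _ := rfl

theorem rookStratumEquiv_le {x y : rookStratum n k K} (h : x ≤ y) :
    rookStratumEquiv n k K y ≤ rookStratumEquiv n k K x :=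
  rankLE_revRow_of_borelOrbit_subset x.1.2 y.1.2 h

theorem rookStratum_le_of_mem {x y : rookStratum n k K}
    (h : (rookStratumEquiv n k K x).1 ∈
      zariskiClosure (lowerUpperOrbit (rookStratumEquiv n k K y).1)) : x ≤ y :=
  borelOrbit_subset_of_mem h

theorem partialInvolutionStratumEquiv_le {x y : partialInvolutionStratum n k K} (h : x ≤ y) :
    partialInvolutionStratumEquiv n k K x ≤ partialInvolutionStratumEquiv n k K y :=
  rankLE_of_congruenceOrbit_subset y.1.2.1 x.1.2.1 ((subset_zariskiClosure _).trans h)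

theorem partialInvolutionStratum_le_of_mem {x y : partialInvolutionStratum n k K}
    (h : y.1.1 ∈ zariskiClosure (congruenceOrbit x.1.1)) : x ≤ y :=
  zariskiClosure_subset (congruenceOrbit_subset_zariskiClosure h)

/-- For `k ≥ n - 1` the closure order on rooks is the opposite of the rank order. -/
def rookStratumOrderIso [Infinite K] (hk : n ≤ k + 1) :
    rookStratum n k K ≃o (RankRook n k K)ᵒᵈ where
  toEquiv := (rookStratumEquiv n k K).trans OrderDual.toDual
  map_rel_iff' := by
    intro x y
    refine ⟨fun h => rookStratum_le_of_mem ?_, fun h => rookStratumEquiv_le h⟩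
    exact RankRook.mem_zariskiClosure_of_le hk (x := rookStratumEquiv n k K y)
      (y := rookStratumEquiv n k K x) h

/-- For `k ≥ n - 1` the closure order on partial involutions is the rank order. -/
def partialInvolutionStratumOrderIso [IsAlgClosed K] [CharZero K] (hk : n ≤ k + 1) :
    partialInvolutionStratum n k K ≃o SymmRankRook n k K where
  toEquiv := partialInvolutionStratumEquiv n k K
  map_rel_iff' := by
    intro x y
    refine ⟨fun h => partialInvolutionStratum_le_of_mem ?_,
      fun h => partialInvolutionStratumEquiv_le h⟩
    exact SymmRankRook.mem_zariskiClosure_of_le hk (x := partialInvolutionStratumEquiv n k K x)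
      (y := partialInvolutionStratumEquiv n k K y) h

end Comparison

/-! ### Three-element intervals -/

section ThreeElements

variable {n k : ℕ} {K : Type*} [Field K]

theorem ncard_Icc_eq_three {α : Type*} [PartialOrder α] {a b c : α} (hab : a ≤ b) (hbc : b ≤ c)
    (hne : a ≠ b) (hne' : b ≠ c) (h : ∀ z, a ≤ z → z ≤ c → z = a ∨ z = b ∨ z = c) :
    (Set.Icc a c).ncard = 3 := by
  have hac : a ≠ c := fun e => hne (le_antisymm hab (e ▸ hbc))
  refine Set.ncard_eq_three.2 ⟨a, b, c, hne, hac, hne', ?_⟩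
  ext z
  simp only [Set.mem_Icc, Set.mem_insert_iff, Set.mem_singleton_iff]
  refine ⟨fun hz => h z hz.1 hz.2, ?_⟩
  rintro (rfl | rfl | rfl)
  · exact ⟨le_rfl, hab.trans hbc⟩
  · exact ⟨hab, hbc⟩
  · exact ⟨hab.trans hbc, le_rfl⟩

open Classical in
/-- The rook matrix with a one at `(r, j)` and ones on the diagonal in the rows
`3, …, k + 1`. -/
def cornerRook (k : ℕ) (K : Type*) [Field K] (r j : Fin n) : Matrix (Fin n) (Fin n) K :=
  Matrix.of fun a b => if (a = r ∧ b = j) ∨ (3 ≤ a.1 ∧ a = b ∧ a.1 < k + 2) then 1 else 0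

theorem cornerRook_eq_one_iff {r j a b : Fin n} : cornerRook k K r j a b = 1 ↔
    (a = r ∧ b = j) ∨ (3 ≤ a.1 ∧ a = b ∧ a.1 < k + 2) := by
  rw [cornerRook, Matrix.of_apply]
  split_ifs with h <;> simp [h]

theorem isRook_cornerRook {r j : Fin n} (hr : r.1 < 3) (hj : j.1 < 3) :
    IsRook (cornerRook k K r j) := by
  refine ⟨fun a b => ?_, fun a b b' h h' => ?_, fun a a' b h h' => ?_⟩
  · rw [cornerRook, Matrix.of_apply]
    split_ifs <;> simp
  all_goals
    rw [cornerRook_eq_one_iff] at h h'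
    simp only [Fin.ext_iff] at h h' ⊢
    omega

theorem numNonzero_cornerRook {r j : Fin n} (hr : r.1 < 3) (hj : j.1 < 3) (hk : 1 ≤ k)
    (hkn : k + 2 ≤ n) : numNonzero (cornerRook k K r j) = k := by
  -- The value `t = 0` lists the corner one; `t = 1, …, k - 1` list the diagonal positions `3, …, k
  -- + 1`, which exist because `k + 2 ≤ n`.
  let f : Fin k → Fin n × Fin n := fun t =>
    if t.1 = 0 then (r, j) else (⟨t.1 + 2, by omega⟩, ⟨t.1 + 2, by omega⟩)
  have hf : Function.Injective f := by
    intro s t h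
    simp only [f] at h
    split_ifs at h with h1 h2 h2 <;> simp only [Prod.mk.injEq, Fin.ext_iff] at h ⊢ <;> omega
  have hset : {p : Fin n × Fin n | cornerRook k K r j p.1 p.2 ≠ 0} = Set.range f := by
    ext ⟨a, b⟩
    have h1 : cornerRook k K r j a b ≠ 0 ↔ cornerRook k K r j a b = 1 := by
      rcases (isRook_cornerRook (k := k) (K := K) hr hj).1 a b with h | h <;> simp [h]
    change cornerRook k K r j a b ≠ 0 ↔ _
    rw [h1, cornerRook_eq_one_iff]
    constructor
    · rintro (⟨rfl, rfl⟩ | ⟨h3, rfl, h4⟩)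
      · exact ⟨⟨0, hk⟩, by simp [f]⟩
      · refine ⟨⟨a.1 - 2, by omega⟩, ?_⟩
        have h5 : a.1 - 2 ≠ 0 := by omega
        have h6 : a.1 - 2 + 2 = a.1 := by omega
        simp [f, h5, h6]
    · rintro ⟨t, ht⟩
      simp only [f] at ht
      split_ifs at ht with h0 <;> simp only [Prod.mk.injEq, Fin.ext_iff] at ht ⊢ <;> omega
  rw [numNonzero, hset, Set.ncard_range_of_injective hf, Nat.card_fin]

theorem map_swap_eq_self {i i' : Fin n} {J : Finset (Fin n)} (h : i ∈ J) (h' : i' ∈ J) :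
    J.map (Equiv.swap i i').toEmbedding = J := by
  ext a
  rw [Finset.mem_map_equiv, Equiv.symm_swap, Equiv.swap_apply_def]
  split_ifs with h1 h2
  · simp [h1, h, h']
  · simp [h2, h, h']
  · rfl

theorem swapCol_cornerRook {r j j' : Fin n} (hj : j.1 < 3) (hj' : j'.1 < 3) :
    swapCol (cornerRook k K r j) j j' = cornerRook k K r j' := by
  ext a b
  simp only [cornerRook, Matrix.submatrix_apply, Matrix.of_apply, id]
  congr 1
  rw [Equiv.swap_apply_def]
  rw [eq_iff_iff]
  split_ifs with h1 h2
  · simp only [Fin.ext_iff] at h1 ⊢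
    omega
  · simp only [Fin.ext_iff, and_true] at h1 h2 ⊢
    omega
  · simp only [Fin.ext_iff] at h1 h2 ⊢
    omega

theorem swapRow_cornerRook {r r' j : Fin n} (hr : r.1 < 3) (hr' : r'.1 < 3) :
    swapRow (cornerRook k K r j) r r' = cornerRook k K r' j := by
  ext a b
  simp only [cornerRook, Matrix.submatrix_apply, Matrix.of_apply, id]
  congr 1
  rw [Equiv.swap_apply_def]
  rw [eq_iff_iff]
  split_ifs with h1 h2
  · simp only [Fin.ext_iff] at h1 ⊢
    omega
  · simp only [Fin.ext_iff, true_and] at h1 h2 ⊢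
    omega
  · simp only [Fin.ext_iff] at h1 h2 ⊢
    omega

theorem swapBoth_cornerRook {j j' : Fin n} (hj : j.1 < 3) (hj' : j'.1 < 3) :
    swapBoth (cornerRook k K j j) j j' = cornerRook k K j' j' := by
  rw [← swapCol_cornerRook (r := j') hj hj', ← swapRow_cornerRook hj hj']
  rfl

theorem isSymm_cornerRook (j : Fin n) : (cornerRook k K j j).IsSymm := by
  ext a b
  simp only [cornerRook, Matrix.transpose_apply, Matrix.of_apply]
  congr 1
  simp only [Fin.ext_iff]
  rw [eq_iff_iff]
  omega

theorem rowLE_cornerRook {r r' j : Fin n} (hr : r' ≠ r) (hr' : r'.1 < 3) :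
    RowLE (cornerRook k K r j) r r' := by
  intro J _
  rw [blockCount_eq_zero.2]
  · exact Nat.zero_le _
  · intro a ha b _ h
    rw [Finset.mem_singleton] at ha
    subst ha
    rw [cornerRook_eq_one_iff] at h
    simp only [Fin.ext_iff, ne_eq] at h hr
    omega

theorem rowLE_transpose_cornerRook {r j j' : Fin n} (hj : j' ≠ j) (hj' : j'.1 < 3) :
    RowLE (cornerRook k K r j).transpose j j' := by
  intro J _
  rw [blockCount_eq_zero.2]
  · exact Nat.zero_le _
  · intro a ha b _ h
    rw [Finset.mem_singleton] at ha
    subst ha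
    rw [Matrix.transpose_apply, cornerRook_eq_one_iff] at h
    simp only [Fin.ext_iff, ne_eq] at h hj
    omega

theorem Iic_eq_insert_Iio (a : Fin n) : Finset.Iic a = insert a (Finset.Iio a) := by
  ext b
  simp [le_iff_eq_or_lt]

theorem isLowerSet_coe_Iic (a : Fin n) :
    IsLowerSet ((Finset.Iic a : Finset (Fin n)) : Set (Fin n)) := by
  rw [Finset.coe_Iic]
  exact isLowerSet_Iic a

theorem isLowerSet_coe_Iio (a : Fin n) :
    IsLowerSet ((Finset.Iio a : Finset (Fin n)) : Set (Fin n)) := by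
  rw [Finset.coe_Iio]
  exact isLowerSet_Iio a

/-- A row of two matrices agrees in count if the upper left blocks ending at and before it do. -/
theorem blockCount_singleton_eq {x y : Matrix (Fin n) (Fin n) K} {a : Fin n}
    {J : Finset (Fin n)} (h : blockCount x (Finset.Iic a) J = blockCount y (Finset.Iic a) J)
    (h' : blockCount x (Finset.Iio a) J = blockCount y (Finset.Iio a) J) :
    blockCount x {a} J = blockCount y {a} J := by
  rw [Iic_eq_insert_Iio, blockCount_insert _ (by simp), blockCount_insert _ (by simp)] at h
  omega

theorem eq_one_iff_of_blockCount_eq {x y : Matrix (Fin n) (Fin n) K} {a b : Fin n}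
    (h : blockCount x {a} (Finset.Iic b) = blockCount y {a} (Finset.Iic b))
    (h' : blockCount x {a} (Finset.Iio b) = blockCount y {a} (Finset.Iio b)) :
    x a b = 1 ↔ y a b = 1 := by
  rw [← blockCount_transpose x, ← blockCount_transpose y] at h h'
  have := blockCount_singleton_eq h h'
  rw [← blockCount_singleton_singleton, ← blockCount_singleton_singleton (x := y),
    ← blockCount_transpose x, ← blockCount_transpose y, this]

/-! ### Rank inequalities confine an interval to corner rooks. -/

section Interval

variable {z : Matrix (Fin n) (Fin n) K} {c₀ c₂ : Fin n}

/-- The two bounds differ by an interchange of columns 0 and 2, so they have equal counts on every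
block whose column set contains column 2, and `z` is squeezed there. This fixes all columns from 3
on and leaves a single one, in row 0, free to move among columns 0, 1, 2. -/
theorem exists_eq_cornerRook_of_rankLE (hz : IsRook z) (h₀ : c₀.1 = 0) (h₂ : c₂.1 = 2)
    (h : RankLE (cornerRook k K c₀ c₀) z) (h' : RankLE z (cornerRook k K c₀ c₂)) :
    ∃ j : Fin n, j.1 < 3 ∧ z = cornerRook k K c₀ j := by
  set x := cornerRook k K c₀ c₀ with hx
  have hxr : IsRook x := isRook_cornerRook (by omega) (by omega)
  have hcount : ∀ I J : Finset (Fin n), IsLowerSet (I : Set (Fin n)) →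
      IsLowerSet (J : Set (Fin n)) → c₂ ∈ J → blockCount z I J = blockCount x I J := by
    intro I J hI hJ hc
    refine le_antisymm (h I J hI hJ) ?_
    have h1 := h' I J hI hJ
    rwa [← swapCol_cornerRook (j := c₀) (by omega) (by omega), blockCount_swapCol,
      map_swap_eq_self (hJ (Fin.le_def.2 (by omega)) hc) hc] at h1
  have hrow : ∀ (a : Fin n) (J : Finset (Fin n)), IsLowerSet (J : Set (Fin n)) → c₂ ∈ J →
      blockCount z {a} J = blockCount x {a} J := fun a J hJ hc =>
    blockCount_singleton_eq (hcount _ _ (isLowerSet_coe_Iic a) hJ hc)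
      (hcount _ _ (isLowerSet_coe_Iio a) hJ hc)
  have hlarge : ∀ a b : Fin n, 3 ≤ b.1 → (z a b = 1 ↔ x a b = 1) := fun a b hb =>
    eq_one_iff_of_blockCount_eq
      (hrow a _ (isLowerSet_coe_Iic b) (by rw [Finset.mem_Iic, Fin.le_def]; omega))
      (hrow a _ (isLowerSet_coe_Iio b) (by rw [Finset.mem_Iio, Fin.lt_def]; omega))
  have hsmall := fun a : Fin n => hrow a _ (isLowerSet_coe_Iic c₂) (by simp)
  have hpos : 1 ≤ blockCount z {c₀} (Finset.Iic c₂) := by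
    rw [hsmall, blockCount_singleton_pos]
    exact ⟨c₀, by rw [Finset.mem_Iic, Fin.le_def]; omega, cornerRook_eq_one_iff.2 (by simp)⟩
  obtain ⟨j, hj, hzj⟩ := blockCount_singleton_pos.1 hpos
  rw [Finset.mem_Iic, Fin.le_def] at hj
  refine ⟨j, by omega, hz.ext (isRook_cornerRook (by omega) (by omega)) fun a b => ?_⟩
  by_cases hb : 3 ≤ b.1
  · rw [hlarge a b hb, hx, cornerRook_eq_one_iff, cornerRook_eq_one_iff]
    simp only [Fin.ext_iff]
    omega
  · by_cases ha : a = c₀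
    · subst ha
      refine ⟨fun h1 => cornerRook_eq_one_iff.2 (Or.inl ⟨rfl, hz.2.1 _ _ _ h1 hzj⟩), fun h1 => ?_⟩
      rw [cornerRook_eq_one_iff] at h1
      rcases h1 with h1 | h1
      · rw [h1.2, hzj]
      · omega
    · refine iff_of_false (fun h1 => ?_) fun h1 => ?_
      · have h2 : 1 ≤ blockCount z {a} (Finset.Iic c₂) :=
          blockCount_singleton_pos.2 ⟨b, by rw [Finset.mem_Iic, Fin.le_def]; omega, h1⟩
        rw [hsmall, blockCount_singleton_pos] at h2
        obtain ⟨d, hd, h3⟩ := h2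
        rw [hx, cornerRook_eq_one_iff] at h3
        simp only [Finset.mem_Iic, Fin.le_def, Fin.ext_iff] at hd h3 ha
        omega
      · rw [cornerRook_eq_one_iff] at h1
        simp only [Fin.ext_iff] at h1 ha
        omega

/-- The bounds agree on blocks containing index 2 in both directions, which fixes everything outside
the 3×3 corner and leaves exactly one one inside it. By symmetry that one is on the diagonal. -/
theorem exists_eq_cornerRook_of_rankLE_of_isSymm (hz : IsRook z) (hs : z.IsSymm)
    (h₀ : c₀.1 = 0) (h₂ : c₂.1 = 2)
    (h : RankLE (cornerRook k K c₀ c₀) z) (h' : RankLE z (cornerRook k K c₂ c₂)) :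
    ∃ j : Fin n, j.1 < 3 ∧ z = cornerRook k K j j := by
  set x := cornerRook k K c₀ c₀ with hx
  have hxr : IsRook x := isRook_cornerRook (by omega) (by omega)
  have hcount : ∀ I J : Finset (Fin n), IsLowerSet (I : Set (Fin n)) →
      IsLowerSet (J : Set (Fin n)) → c₂ ∈ I → c₂ ∈ J → blockCount z I J = blockCount x I J := by
    intro I J hI hJ hcI hcJ
    refine le_antisymm (h I J hI hJ) ?_
    have h1 := h' I J hI hJ
    rwa [← swapBoth_cornerRook (j := c₀) (by omega) (by omega), blockCount_submatrix,
      map_swap_eq_self (hJ (Fin.le_def.2 (by omega)) hcJ) hcJ,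
      map_swap_eq_self (hI (Fin.le_def.2 (by omega)) hcI) hcI] at h1
  have hrow : ∀ (a : Fin n) (J : Finset (Fin n)), 3 ≤ a.1 → IsLowerSet (J : Set (Fin n)) →
      c₂ ∈ J → blockCount z {a} J = blockCount x {a} J := fun a J ha hJ hc =>
    blockCount_singleton_eq
      (hcount _ _ (isLowerSet_coe_Iic a) hJ (by rw [Finset.mem_Iic, Fin.le_def]; omega) hc)
      (hcount _ _ (isLowerSet_coe_Iio a) hJ (by rw [Finset.mem_Iio, Fin.lt_def]; omega) hc)
  have hlarge : ∀ a b : Fin n, 3 ≤ a.1 → (z a b = 1 ↔ x a b = 1) := by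
    intro a b ha
    by_cases hb : 3 ≤ b.1
    · exact eq_one_iff_of_blockCount_eq
        (hrow a _ ha (isLowerSet_coe_Iic b) (by rw [Finset.mem_Iic, Fin.le_def]; omega))
        (hrow a _ ha (isLowerSet_coe_Iio b) (by rw [Finset.mem_Iio, Fin.lt_def]; omega))
    · have h1 : blockCount x {a} (Finset.Iic c₂) = 0 := by
        rw [blockCount_eq_zero]
        intro d hd e he h1
        rw [hx, cornerRook_eq_one_iff] at h1
        simp only [Finset.mem_singleton, Finset.mem_Iic, Fin.le_def, Fin.ext_iff] at hd he h1
        omega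
      have h2 := hrow a _ ha (isLowerSet_coe_Iic c₂) (by simp)
      rw [h1] at h2
      rw [blockCount_eq_zero] at h1 h2
      have hb' : b ∈ Finset.Iic c₂ := by rw [Finset.mem_Iic, Fin.le_def]; omega
      exact iff_of_false (h2 a (by simp) b hb') (h1 a (by simp) b hb')
  have hcorner := hcount _ _ (isLowerSet_coe_Iic c₂) (isLowerSet_coe_Iic c₂) (by simp) (by simp)
  have hone : blockCount x (Finset.Iic c₂) (Finset.Iic c₂) = 1 := by
    rw [blockCount_eq_sum_rows, Finset.sum_eq_single c₀]
    · refine le_antisymm (hxr.blockCount_singleton_le _ _) (blockCount_singleton_pos.2 ?_)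
      exact ⟨c₀, by rw [Finset.mem_Iic, Fin.le_def]; omega, cornerRook_eq_one_iff.2 (by simp)⟩
    · intro a ha ha'
      rw [blockCount_eq_zero]
      intro d hd e he h1
      rw [hx, cornerRook_eq_one_iff] at h1
      simp only [Finset.mem_singleton, Finset.mem_Iic, Fin.le_def, Fin.ext_iff] at hd he h1 ha ha'
      omega
    · intro hc
      rw [Finset.mem_Iic, Fin.le_def] at hc
      omega
  rw [hone] at hcorner
  have huniq : ∀ a b d e : Fin n, a.1 < 3 → b.1 < 3 → d.1 < 3 → e.1 < 3 → z a b = 1 →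
      z d e = 1 → a = d := by
    intro a b d e ha hb hd he h1 h2
    by_contra hne
    have hsub : insert a {d} ⊆ Finset.Iic c₂ := by
      intro t ht
      rw [Finset.mem_insert, Finset.mem_singleton] at ht
      rw [Finset.mem_Iic, Fin.le_def]
      rcases ht with rfl | rfl <;> omega
    have h3 := blockCount_mono z hsub (le_refl (Finset.Iic c₂))
    rw [blockCount_insert _ (by simpa using hne)] at h3
    have h4 : 1 ≤ blockCount z {a} (Finset.Iic c₂) :=
      blockCount_singleton_pos.2 ⟨b, by rw [Finset.mem_Iic, Fin.le_def]; omega, h1⟩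
    have h5 : 1 ≤ blockCount z {d} (Finset.Iic c₂) :=
      blockCount_singleton_pos.2 ⟨e, by rw [Finset.mem_Iic, Fin.le_def]; omega, h2⟩
    omega
  have hex : ∃ j : Fin n, j.1 < 3 ∧ z j j = 1 := by
    have hne : blockCount z (Finset.Iic c₂) (Finset.Iic c₂) ≠ 0 := by omega
    rw [ne_eq, blockCount_eq_zero] at hne
    push Not at hne
    obtain ⟨a, ha, b, hb, hab⟩ := hne
    rw [Finset.mem_Iic, Fin.le_def] at ha hb
    have hba : z b a = 1 := by rw [hs.apply, hab]
    have : a = b := huniq a b b a (by omega) (by omega) (by omega) (by omega) hab hba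
    subst this
    exact ⟨a, by omega, hab⟩
  obtain ⟨j, hj, hzj⟩ := hex
  refine ⟨j, hj, hz.ext (isRook_cornerRook hj hj) fun a b => ?_⟩
  have hlarge' : ∀ a b : Fin n, 3 ≤ a.1 → (z a b = 1 ↔ cornerRook k K j j a b = 1) := by
    intro a b ha
    rw [hlarge a b ha, hx, cornerRook_eq_one_iff, cornerRook_eq_one_iff]
    simp only [Fin.ext_iff]
    omega
  by_cases ha : 3 ≤ a.1
  · exact hlarge' a b ha
  by_cases hb : 3 ≤ b.1
  · rw [← hs.apply, ← (isSymm_cornerRook j).apply]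
    exact hlarge' b a hb
  · constructor
    · intro h1
      have e1 : a = j := huniq a b j j (by omega) (by omega) hj hj h1 hzj
      have e2 : b = j := huniq b a j j (by omega) (by omega) hj hj (by rw [hs.apply, h1]) hzj
      exact cornerRook_eq_one_iff.2 (Or.inl ⟨e1, e2⟩)
    · intro h1
      rw [cornerRook_eq_one_iff] at h1
      rcases h1 with ⟨rfl, rfl⟩ | h1
      · exact hzj
      · omega

end Interval

theorem cornerRook_ne {r j r' j' : Fin n} (hr : r.1 < 3) (h : r ≠ r' ∨ j ≠ j') :
    cornerRook k K r j ≠ cornerRook k K r' j' := by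
  intro e
  have h1 : cornerRook k K r' j' r j = 1 := by
    rw [← e]
    exact cornerRook_eq_one_iff.2 (Or.inl ⟨rfl, rfl⟩)
  rw [cornerRook_eq_one_iff] at h1
  rcases h1 with h1 | h1
  · exact h.elim (fun h => h h1.1) fun h => h h1.2
  · omega

theorem covBy_of_val_eq_add_one {i i' : Fin n} (h : i'.1 = i.1 + 1) : i ⋖ i' :=
  ⟨Fin.lt_def.2 (by omega), fun c h1 h2 => by
    rw [Fin.lt_def] at h1 h2
    omega⟩

/-- The chain is `j = 2, 1, 0` from bottom to top, since `rookStratumEquiv` reverses the order. The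
comparisons come from ascents, which work for any `k`; only the necessity of the rank conditions is
used to exclude other elements. -/
theorem exists_ncard_Icc_rookStratum [Infinite K] (hk : 1 ≤ k) (hkn : k + 2 ≤ n) :
    ∃ x y : rookStratum n k K, (Set.Icc x y).ncard = 3 := by
  obtain ⟨c₀, h₀⟩ : ∃ c : Fin n, c.1 = 0 := ⟨⟨0, by omega⟩, rfl⟩
  obtain ⟨c₁, h₁⟩ : ∃ c : Fin n, c.1 = 1 := ⟨⟨1, by omega⟩, rfl⟩
  obtain ⟨c₂, h₂⟩ : ∃ c : Fin n, c.1 = 2 := ⟨⟨2, by omega⟩, rfl⟩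
  let R : ∀ j : Fin n, j.1 < 3 → RankRook n k K := fun j hj =>
    ⟨cornerRook k K c₀ j, isRook_cornerRook (by omega) hj,
      numNonzero_cornerRook (by omega) hj hk hkn⟩
  let e := rookStratumEquiv n k K
  have hle : ∀ (j j' : Fin n) (hj : j.1 < 3) (hj' : j'.1 < 3), j'.1 = j.1 + 1 →
      e.symm (R j' hj') ≤ e.symm (R j hj) := by
    intro j j' hj hj' hjj
    refine rookStratum_le_of_mem ?_
    change (e (e.symm _)).1 ∈ zariskiClosure (lowerUpperOrbit (e (e.symm _)).1)
    rw [e.apply_symm_apply, e.apply_symm_apply]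
    change cornerRook k K c₀ j' ∈ zariskiClosure (lowerUpperOrbit (cornerRook k K c₀ j))
    rw [← swapCol_cornerRook hj hj']
    exact (R j hj).2.1.swapCol_mem_zariskiClosure (covBy_of_val_eq_add_one hjj)
      (rowLE_transpose_cornerRook (fun h => by rw [h] at hjj; omega) hj')
      (subset_zariskiClosure _ (self_mem_lowerUpperOrbit _))
  have hne : ∀ (j j' : Fin n) (hj : j.1 < 3) (hj' : j'.1 < 3), j.1 ≠ j'.1 →
      e.symm (R j hj) ≠ e.symm (R j' hj') := fun j j' hj hj' hjj h =>
    cornerRook_ne (k := k) (K := K) (by omega) (Or.inr fun h' => hjj (congrArg Fin.val h'))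
      (congrArg Subtype.val (e.symm.injective h))
  refine ⟨e.symm (R c₂ (by omega)), e.symm (R c₀ (by omega)),
    ncard_Icc_eq_three (hle c₁ c₂ (by omega) (by omega) (by omega))
      (hle c₀ c₁ (by omega) (by omega) (by omega))
      (hne c₂ c₁ (by omega) (by omega) (by omega))
      (hne c₁ c₀ (by omega) (by omega) (by omega)) fun z hz hz' => ?_⟩
  have h1 := rookStratumEquiv_le hz
  have h2 := rookStratumEquiv_le hz'
  change e z ≤ e (e.symm _) at h1
  change e (e.symm _) ≤ e z at h2
  rw [e.apply_symm_apply] at h1 h2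
  obtain ⟨j, hj, hzj⟩ := exists_eq_cornerRook_of_rankLE (e z).2.1 h₀ h₂ h2 h1
  have hzR : z = e.symm (R j hj) := by
    rw [Equiv.eq_symm_apply]
    exact Subtype.ext hzj
  have hj' : j = c₀ ∨ j = c₁ ∨ j = c₂ := by
    simp only [Fin.ext_iff]
    omega
  rcases hj' with rfl | rfl | rfl
  · exact Or.inr (Or.inr hzR)
  · exact Or.inr (Or.inl hzR)
  · exact Or.inl hzR

theorem exists_ncard_Icc_partialInvolutionStratum [IsAlgClosed K] [CharZero K] (hk : 1 ≤ k)
    (hkn : k + 2 ≤ n) :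
    ∃ x y : partialInvolutionStratum n k K, (Set.Icc x y).ncard = 3 := by
  obtain ⟨c₀, h₀⟩ : ∃ c : Fin n, c.1 = 0 := ⟨⟨0, by omega⟩, rfl⟩
  obtain ⟨c₁, h₁⟩ : ∃ c : Fin n, c.1 = 1 := ⟨⟨1, by omega⟩, rfl⟩
  obtain ⟨c₂, h₂⟩ : ∃ c : Fin n, c.1 = 2 := ⟨⟨2, by omega⟩, rfl⟩
  let R : ∀ j : Fin n, j.1 < 3 → partialInvolutionStratum n k K := fun j hj =>
    ⟨⟨cornerRook k K j j, isRook_cornerRook hj hj, isSymm_cornerRook j⟩,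
      numNonzero_cornerRook hj hj hk hkn⟩
  have hle : ∀ (j j' : Fin n) (hj : j.1 < 3) (hj' : j'.1 < 3), j'.1 = j.1 + 1 →
      R j hj ≤ R j' hj' := by
    intro j j' hj hj' hjj
    refine partialInvolutionStratum_le_of_mem ?_
    change cornerRook k K j' j' ∈ zariskiClosure (congruenceOrbit (cornerRook k K j j))
    rw [← swapBoth_cornerRook hj hj']
    exact (isRook_cornerRook hj hj).swapBoth_mem_zariskiClosure (isSymm_cornerRook j)
      (covBy_of_val_eq_add_one hjj) (rowLE_cornerRook (fun h => by rw [h] at hjj; omega) hj')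
      (subset_zariskiClosure _ (self_mem_congruenceOrbit _))
  have hne : ∀ (j j' : Fin n) (hj : j.1 < 3) (hj' : j'.1 < 3), j.1 ≠ j'.1 →
      R j hj ≠ R j' hj' := fun j j' hj hj' hjj h =>
    cornerRook_ne (k := k) (K := K) hj (Or.inr fun h' => hjj (congrArg Fin.val h'))
      (congrArg (fun w : partialInvolutionStratum n k K => w.1.1) h)
  refine ⟨R c₀ (by omega), R c₂ (by omega),
    ncard_Icc_eq_three (hle c₀ c₁ (by omega) (by omega) (by omega))
      (hle c₁ c₂ (by omega) (by omega) (by omega))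
      (hne c₀ c₁ (by omega) (by omega) (by omega))
      (hne c₁ c₂ (by omega) (by omega) (by omega)) fun z hz hz' => ?_⟩
  obtain ⟨j, hj, hzj⟩ := exists_eq_cornerRook_of_rankLE_of_isSymm z.1.2.1 z.1.2.2 h₀ h₂
    (partialInvolutionStratumEquiv_le hz) (partialInvolutionStratumEquiv_le hz')
  have hzR : z = R j hj := Subtype.ext (Subtype.ext hzj)
  have hj' : j = c₀ ∨ j = c₁ ∨ j = c₂ := by
    simp only [Fin.ext_iff]
    omega
  rcases hj' with rfl | rfl | rfl
  · exact Or.inl hzR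
  · exact Or.inr (Or.inl hzR)
  · exact Or.inr (Or.inr hzR)

end ThreeElements

/-! ### The Eulerian strata -/

section Eulerian

variable {n k : ℕ} {K : Type*} [Field K]

open Classical in
/-- The diagonal rook matrix with `k` ones. -/
theorem exists_isRook_isSymm (K : Type*) [Field K] (hkn : k ≤ n) :
    ∃ x : Matrix (Fin n) (Fin n) K, (IsRook x ∧ x.IsSymm) ∧ numNonzero x = k := by
  refine ⟨Matrix.diagonal fun i => if i.1 < k then 1 else 0,
    ⟨⟨fun i j => ?_, fun i j j' h h' => ?_, fun i i' j h h' => ?_⟩,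
      Matrix.isSymm_diagonal _⟩, ?_⟩
  · rw [Matrix.diagonal_apply]
    split_ifs <;> simp
  · rw [Matrix.diagonal_apply] at h h'
    split_ifs at h h' <;> simp_all
  · rw [Matrix.diagonal_apply] at h h'
    split_ifs at h h' <;> simp_all
  · have : {p : Fin n × Fin n | Matrix.diagonal (fun i : Fin n => if i.1 < k then (1 : K) else 0)
        p.1 p.2 ≠ 0} = Set.range fun t : Fin k => (Fin.castLE hkn t, Fin.castLE hkn t) := by
      ext ⟨a, b⟩
      simp only [Set.mem_ofPred_eq, Matrix.diagonal_apply, Set.mem_range, Prod.mk.injEq]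
      constructor
      · intro h
        split_ifs at h with h1 h2
        · subst h1
          exact ⟨⟨a.1, h2⟩, rfl, rfl⟩
        all_goals exact absurd rfl h
      · rintro ⟨t, rfl, rfl⟩
        simp
    rw [numNonzero, this, Set.ncard_range_of_injective, Nat.card_fin]
    intro s t h
    exact Fin.castLE_injective hkn (congrArg Prod.fst h)

theorem isEulerianPoset_rookStratum [Infinite K] (hkn : k ≤ n) (hk : n ≤ k + 1) :
    IsEulerianPoset (rookStratum n k K) := by
  have : Finite (rookStratum n k K) := Finite.of_equiv _ (rookStratumEquiv n k K).symm
  obtain ⟨x, hx, hxk⟩ := exists_isRook_isSymm K hkn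
  have : Nonempty (rookStratum n k K) := ⟨⟨⟨x, hx.1⟩, hxk⟩⟩
  exact ((RankRook.isLiftingSystem_swap hk).dual.of_orderIso
    (rookStratumOrderIso hk)).isEulerianPoset

theorem isEulerianPoset_partialInvolutionStratum [IsAlgClosed K] [CharZero K] (hkn : k ≤ n)
    (hk : n ≤ k + 1) : IsEulerianPoset (partialInvolutionStratum n k K) := by
  have : Finite (partialInvolutionStratum n k K) :=
    Finite.of_equiv _ (partialInvolutionStratumEquiv n k K).symm
  obtain ⟨x, hx, hxk⟩ := exists_isRook_isSymm K hkn
  have : Nonempty (partialInvolutionStratum n k K) := ⟨⟨⟨x, hx⟩, hxk⟩⟩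
  exact ((SymmRankRook.isLiftingSystem_swap hk).of_orderIso
    (partialInvolutionStratumOrderIso hk)).isEulerianPoset

end Eulerian

theorem theorem1p2 (K : Type*) [Field K] [IsAlgClosed K] [CharZero K]
    (n k : ℕ) (hk : 1 ≤ k) (hkn : k ≤ n) :
    (IsEulerianPoset (rookStratum n k K) ↔ k = n ∨ k + 1 = n) ∧
    (IsEulerianPoset (partialInvolutionStratum n k K) ↔ k = n ∨ k + 1 = n) ∧
    (k + 2 ≤ n →
      (∃ x y : rookStratum n k K, (Set.Icc x y).ncard = 3) ∧
      (∃ x y : partialInvolutionStratum n k K, (Set.Icc x y).ncard = 3)) := by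
  have : Infinite K := IsAlgClosed.instInfinite
  refine ⟨⟨fun h => ?_, fun h => isEulerianPoset_rookStratum hkn (by omega)⟩,
    ⟨fun h => ?_, fun h => isEulerianPoset_partialInvolutionStratum hkn (by omega)⟩,
    fun h => ⟨exists_ncard_Icc_rookStratum hk h,
      exists_ncard_Icc_partialInvolutionStratum hk h⟩⟩
  -- With `k ≤ n`, failure of both equalities means `k + 2 ≤ n`, so a three-element interval exists.
  · by_contra hcon
    obtain ⟨x, y, hxy⟩ := exists_ncard_Icc_rookStratum (K := K) hk (by omega : k + 2 ≤ n)
    exact not_isEulerianPoset_of_ncard_Icc hxy h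
  · by_contra hcon
    obtain ⟨x, y, hxy⟩ :=
      exists_ncard_Icc_partialInvolutionStratum (K := K) hk (by omega : k + 2 ≤ n)
    exact not_isEulerianPoset_of_ncard_Icc hxy h
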